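/- Let $Q$ be the generator of an irreducible continuous-time Markov chain on a finite set $\mathcal X$, reversible with respect to its stationary distribution $\pi$, i.e. $\pi(x)Q(x,y)=\pi(y)Q(y,x)$, and let $U:\mathcal X\to\mathbb R$ satisfy $\min U=0$. For $\tau>0$ let $M_2^{\tau}$ be the generator with off-diagonal entries $M_2^{\tau}(x,y)=Q(x,y)\max\{1,e^{(U(x)-U(y))/\tau}\}$, $x\neq y$, and zero row sums; for $\tau=\infty$ put $M_2^\infty=Q$. A path from $x$ to $y$ is a sequence $x=\gamma_0,\gamma_1,\dots,\gamma_n=y$ with $Q(\gamma_{i-1},\gamma_i)>0$ for all $i$; put $\mathrm{Elev}_2(\gamma)=\max_{1\le i\le n}\min\{U(\gamma_{i-1}),U(\gamma_i)\}$, let $H_2(x,y)$ be the minimum of $\mathrm{Elev}_2$ over all paths from $x$ to $y$, and let $$c_{M_2}=\max_{x\ne y}\{H_2(x,y)-U(x)-U(y)\}.$$ Let $U_{min}=\{x: U(x)=\min U\}$, $R=\max U-\min U$, $K=\pi(U_{min})^{-1}-1$, $B=\min_{x\notin U_{min}}U(x)-\min U$, and write $\lambda_2(L)$ for the second smallest eigenvalue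 of $L$, counted with multiplicity. Suppose that $c_{M_2}>0$. (a) There are paths $\gamma^{x,y}$ from $x$ to $y$ ($x,y\in\mathcal X$) such that $\mathrm{Elev}_2(\gamma^{x,y})=H_2(x,y)$ for all $x\neq y$. For every such choice, let $N$ be the largest length of the paths $\gamma^{x,y}$ and let $\chi_{z,w}(x,y)$ be $1$ if $\gamma^{x,y}$ makes the step from $z$ to $w$ and $0$ otherwise. Then the number $A$ defined by $$A^{-1}=N\max_{z,w}\sum_{x,y}\frac{\chi_{z,w}(x,y)}{\pi(z)Q(z,w)}\,\frac{\pi(x)\pi(y)}{\pi(U_{min})}$$ (terms with $\chi_{z,w}(x,y)=0$ being $0$) satisfies $A>0$ and $$\lambda_2(-M_2^{\tau})\ge A\,e^{-c_{M_2}/\tau}\quad\text{for all }\tau>0.\qquad(*)$$ (b) Let $A>0$ be any constant that satisfies $(*)$, and let $\rho=\frac{2c_{M_2}A}{3R}$ and $T(t)=\frac{c_{M_2}}{\log(\rho t+1)}$ for $t\ge0$, with $T(0)=\infty$. If $X^{M_2}=(X^{M_2}_t)_{t\ge0}$ is a non-homogeneous Markov chain with generators $M_{2,t}=M_2^{T(t)}$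 started in $x\in\mathcal X$, then for all $t\ge0$ $$\mathbb P_x(X^{M_2}_t\notin U_{min})\le 5K(\rho t+1)^{-\frac{B}{c_{M_2}}}+\left(\pi(x)^{-1}-1\right)^{1/2}K^{1/2}(\rho t+1)^{-\frac{R+B/2}{c_{M_2}}}.$$ -/

import Mathlib

open MeasureTheory

noncomputable section

namespace Annealing

/-- A path from `x` to `y`: states `x = x₀, x₁, …, xₙ = y` with `Q(xᵢ₋₁, xᵢ) > 0` for
`i = 1, …, n`. -/
structure QPath {S : Type*} (Q : Matrix S S ℝ) (x y : S) where
  length : ℕ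
  vertex : Fin (length + 1) → S
  source : vertex 0 = x
  target : vertex (Fin.last length) = y
  edge : ∀ i : Fin length, 0 < Q (vertex i.castSucc) (vertex i.succ)

/-- The proposal chain: `Q` is the generator of an ergodic (that is, irreducible)
continuous-time Markov chain on the finite set `S`, reversible with respect to the probability
distribution `π` (which is then its stationary distribution). -/
structure IsProposal {S : Type*} [Fintype S] (Q : Matrix S S ℝ) (π : S → ℝ) : Prop where
  off_diag_nonneg : ∀ x y, x ≠ y → 0 ≤ Q x y
  row_sum : ∀ x, ∑ y, Q x y = 0
  irreducible : ∀ x y, x ≠ y → Nonempty (QPath Q x y)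
  prob_nonneg : ∀ x, 0 ≤ π x
  prob_sum : ∑ x, π x = 1
  detailed_balance : ∀ x y, π x * Q x y = π y * Q y x

/-- The generator `M₂` of the improved annealing variant at temperature `τ`. For `τ = 0` the
convention `a / 0 = 0` makes this `Q`, which is the value at infinite temperature. -/
def gen₂ {S : Type*} [Fintype S] [DecidableEq S] (Q : Matrix S S ℝ) (U : S → ℝ) (τ : ℝ) :
    Matrix S S ℝ :=
  Matrix.of fun x y =>
    if x = y then
      -∑ z ∈ Finset.univ.filter (fun z => z ≠ x), Q x z * max 1 (Real.exp ((U x - U z) / τ))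
    else Q x y * max 1 (Real.exp ((U x - U y) / τ))

/-- The second smallest eigenvalue `λ₂(L)` of a square matrix `L`, the real eigenvalues being
counted with multiplicity and arranged in non-decreasing order. -/
def lambda₂ {S : Type*} [Fintype S] [DecidableEq S] (L : Matrix S S ℝ) : ℝ :=
  (L.charpoly.roots.sort (· ≤ ·)).getD 1 0

/-- `Elev₂(γ)`: the maximum of `U(γᵢ₋₁) ∧ U(γᵢ)` over the steps of the path `γ`. -/
def elev₂ {S : Type*} {Q : Matrix S S ℝ} (U : S → ℝ) {x y : S} (γ : QPath Q x y) : ℝ :=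
  ⨆ i : Fin γ.length, min (U (γ.vertex i.castSucc)) (U (γ.vertex i.succ))

/-- `H₂(x, y)`: the minimum of `Elev₂` over the paths from `x` to `y`. -/
def H₂ {S : Type*} (Q : Matrix S S ℝ) (U : S → ℝ) (x y : S) : ℝ :=
  ⨅ γ : QPath Q x y, elev₂ U γ

/-- The hill-climbing constant `c_{M₂}`: the maximum of `H₂(x, y) - U(x) - U(y)` over pairs of
distinct states. (For `x = y` the constant path has no step, and closed paths with a step give
`H₂(x, x) - 2 U(x) ≤ -U(x) ≤ 0` when `min U = 0`, so the diagonal does not affect a positive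
maximum.) -/
def c₂ {S : Type*} (Q : Matrix S S ℝ) (U : S → ℝ) : ℝ :=
  ⨆ p : {p : S × S // p.1 ≠ p.2}, (H₂ Q U p.1.1 p.1.2 - U p.1.1 - U p.1.2)

/-- The set of global minima of `U`. -/
def Umin {S : Type*} (U : S → ℝ) : Set S := {x | U x = ⨅ y, U y}

/-- `π(U_min)`. -/
def massMin {S : Type*} [Fintype S] (π U : S → ℝ) : ℝ :=
  open Classical in ∑ x ∈ Finset.univ.filter (fun x => x ∈ Umin U), π x

/-- `R = max U - min U`. -/
def constR {S : Type*} (U : S → ℝ) : ℝ := (⨆ x, U x) - ⨅ x, U x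

/-- `K = π(U_min)⁻¹ - 1`. -/
def constK {S : Type*} [Fintype S] (π U : S → ℝ) : ℝ := (massMin π U)⁻¹ - 1

/-- `B`: the minimum of `U` off `U_min`, minus `min U`. -/
def constB {S : Type*} (U : S → ℝ) : ℝ := sInf (U '' (Umin U)ᶜ) - ⨅ x, U x

/-- A choice of paths is optimal if the path chosen from `x` to `y ≠ x` attains `H₂(x, y)`. -/
def IsOptimal {S : Type*} {Q : Matrix S S ℝ} (U : S → ℝ) (γ : ∀ x y : S, QPath Q x y) : Prop :=
  ∀ x y, x ≠ y → elev₂ U (γ x y) = H₂ Q U x y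

/-- `χ_{z,w}(γ)`: equal to `1` if the path `γ` makes the step from `z` to `w`, and to `0`
otherwise. -/
def chi {S : Type*} {Q : Matrix S S ℝ} {x y : S} (γ : QPath Q x y) (z w : S) : ℝ :=
  open Classical in
  if ∃ i : Fin γ.length, γ.vertex i.castSucc = z ∧ γ.vertex i.succ = w then 1 else 0

/-- The constant `A` belonging to a choice of paths `γ`:
`A⁻¹ = N max_{z,w} ∑_{x,y} (χ_{z,w}(x,y) / (π(z) Q(z,w))) π(x) π(y) / π(U_min)`, where `N` is the
largest length of a chosen path, and a term with `χ_{z,w}(x,y) = 0` is `0`. -/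
def pathA {S : Type*} [Fintype S] {Q : Matrix S S ℝ} (π U : S → ℝ)
    (γ : ∀ x y : S, QPath Q x y) : ℝ :=
  (((Finset.univ.sup fun p : S × S => (γ p.1 p.2).length : ℕ) : ℝ) *
    ⨆ q : S × S, ∑ x, ∑ y,
      chi (γ x y) q.1 q.2 / (π q.1 * Q q.1 q.2) * (π x * π y / massMin π U))⁻¹

/-- `A` is a constant for the spectral gap estimate `λ₂(-M₂) ≥ A exp(-c_{M₂} / τ)` at all
temperatures `τ > 0`. -/
def IsGapConstant {S : Type*} [Fintype S] [DecidableEq S] (Q : Matrix S S ℝ) (U : S → ℝ)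
    (A : ℝ) : Prop :=
  0 < A ∧ ∀ τ : ℝ, 0 < τ → A * Real.exp (-(c₂ Q U) / τ) ≤ lambda₂ (-(gen₂ Q U τ))

/-- `ρ = 2 c_{M₂} A / (3 R)`. -/
def rho {S : Type*} (Q : Matrix S S ℝ) (U : S → ℝ) (A : ℝ) : ℝ :=
  2 * c₂ Q U * A / (3 * constR U)

/-- The cooling schedule `T(t) = c_{M₂} / log (ρ t + 1)`. -/
def cooling {S : Type*} (Q : Matrix S S ℝ) (U : S → ℝ) (A t : ℝ) : ℝ :=
  c₂ Q U / Real.log (rho Q U A * t + 1)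

/-- `P` is the transition semigroup `(P_{s,t})_{0 ≤ s ≤ t}` generated by `(M_t)_{t ≥ 0}`: the
solution of the Kolmogorov forward equation `∂ₜ P_{s,t} = P_{s,t} M_t`, `P_{s,s} = I`. -/
def IsTransitionSemigroup {S : Type*} [Fintype S] [DecidableEq S] (M : ℝ → Matrix S S ℝ)
    (P : ℝ → ℝ → Matrix S S ℝ) : Prop :=
  ∀ s, 0 ≤ s → P s s = 1 ∧
    ∀ t, s ≤ t → ∀ x y,
      HasDerivWithinAt (fun u => P s u x y) ((P s t * M t) x y) (Set.Ici s) t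

/-- `X = (X_t)_{t ≥ 0}` is, under `ℙ`, a non-homogeneous continuous-time Markov chain on `S` with
generators `(M_t)_{t ≥ 0}`, started in `x`: its finite-dimensional distributions are
`ℙ(X_{t₀} = y₀, …, X_{tₙ} = yₙ) = 1{y₀ = x} P_{t₀,t₁}(y₀, y₁) ⋯ P_{tₙ₋₁,tₙ}(yₙ₋₁, yₙ)`
for `0 = t₀ ≤ t₁ ≤ … ≤ tₙ`. -/
structure IsMarkovChain {S : Type*} [Fintype S] [DecidableEq S] {Ω : Type*} [MeasurableSpace Ω]
    (ℙ : Measure Ω) (M : ℝ → Matrix S S ℝ) (x : S) (X : ℝ → Ω → S) : Prop where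
  measurable : ∀ t, 0 ≤ t → ∀ y, MeasurableSet {ω | X t ω = y}
  law : ∃ P : ℝ → ℝ → Matrix S S ℝ, IsTransitionSemigroup M P ∧
    ∀ (n : ℕ) (t : Fin (n + 1) → ℝ) (y : Fin (n + 1) → S), t 0 = 0 → Monotone t →
      ℙ.real {ω | ∀ i, X (t i) ω = y i} =
        (if y 0 = x then 1 else 0) *
          ∏ i : Fin n, P (t i.castSucc) (t i.succ) (y i.castSucc) (y i.succ)

end Annealing

end

/-! Write `β = 1/τ` and let `m = π e^{-βU}` be the Gibbs weight, of total mass `Z`. The generator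
`M₂` is reversible for `m`, with conductances `m(x) M₂(x,y) = π(x) Q(x,y) e^{-β min(U(x),U(y))}`.

(a) This is the method of canonical paths. Along an optimal path from `x` to `y`, each step has
`min(U(z),U(w)) ≤ H₂(x,y) ≤ c₂ + U(x) + U(y)`, so `m(x)m(y)` is at most `e^{βc₂} π(x)π(y) /
(π(z)Q(z,w))` times the conductance (`chi_mul_gibbsWeight_le`). Cauchy–Schwarz along the paths, `Z ≥
π(U_min)` and an exchange of sums give a Poincaré inequality, which is a lower bound on `λ₂`
(`isGapConstant_pathA`).

(b) Let `u` be the `χ²`-distance of the law at time `t` from the current Gibbs distribution.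
Reversibility and the gap `A/(ρt+1)` make `u` decay, while cooling moves the target at rate `β'`
(`chiSq_rate_le`). The choice of `ρ` makes the gap `(3/2) β' R`, so that `u' ≤ β' R (-2u + 2 √K
e^{-βB/2} √u)`. Integration gives `√u ≤ (π(x)⁻¹ - 1)^{1/2} e^{-βR} + 2 √K e^{-βB/2}`
(`sqrt_chiSq_le`). The Gibbs mass off `U_min` is at most `K e^{-βB}`, and Cauchy–Schwarz transfers
this to the chain (`annealing_bound`), even with `3K` in place of `5K`. -/

noncomputable section

set_option linter.unusedSectionVars false

namespace Annealing

/-! ### Second eigenvalue and Poincaré inequality -/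

section Spectral

variable {S : Type*} [Fintype S] [DecidableEq S]

open Matrix in
/-- A matrix that is symmetric in `ℓ²(m)` has an orthonormal basis of eigenvectors in `ℓ²(m)`,
and the eigenvalues are the roots of its characteristic polynomial. -/
theorem exists_weighted_eigenbasis {m : S → ℝ} (hm : ∀ x, 0 < m x) {L : Matrix S S ℝ}
    (hL : ∀ x y, m x * L x y = m y * L y x) :
    ∃ (lam : S → ℝ) (φ : S → S → ℝ),
      L.charpoly.roots = Multiset.map lam Finset.univ.val ∧
      (∀ i x, ∑ y, L x y * φ i y = lam i * φ i x) ∧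
      (∀ i j, ∑ x, m x * φ i x * φ j x = if i = j then 1 else 0) ∧
      (∀ f : S → ℝ, ∀ x, f x = ∑ i, (∑ y, m y * φ i y * f y) * φ i x) := by
  set r : S → ℝ := fun x => √(m x) with hr
  have hr0 : ∀ x, 0 < r x := fun x => Real.sqrt_pos.2 (hm x)
  have hrne : ∀ x, r x ≠ 0 := fun x => (hr0 x).ne'
  have hr2 : ∀ x, m x = r x * r x := fun x => (Real.mul_self_sqrt (hm x).le).symm
  -- Conjugation by `diag √m` turns symmetry in `ℓ²(m)` into ordinary symmetry and preserves the
  -- characteristic polynomial.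
  set B : Matrix S S ℝ := diagonal r * L * diagonal (fun x => (r x)⁻¹) with hB
  have hBapp : ∀ x y, B x y = r x * L x y * (r y)⁻¹ := fun x y => by
    rw [hB, mul_diagonal, diagonal_mul]
  have hcp : B.charpoly = L.charpoly := by
    rw [hB, charpoly_mul_comm, ← mul_assoc, diagonal_mul_diagonal]
    have : (fun i => (r i)⁻¹ * r i) = fun _ => (1 : ℝ) := by
      funext i; exact inv_mul_cancel₀ (hrne i)
    rw [this, diagonal_one, one_mul]
  have hherm : B.IsHermitian := by
    ext x y
    rw [conjTranspose_apply, hBapp, hBapp, star_trivial]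
    have h := hL x y
    rw [hr2, hr2] at h
    have hx := hrne x
    have hy := hrne y
    field_simp
    nlinarith [h]
  set u := hherm.eigenvectorBasis with hu
  refine ⟨hherm.eigenvalues, fun i x => u i x / r x, ?_, ?_, ?_, ?_⟩
  · rw [← hcp, hherm.roots_charpoly_eq_eigenvalues]
    rfl
  · intro i x
    have h := congrFun (hherm.mulVec_eigenvectorBasis i) x
    simp only [mulVec, dotProduct, hBapp, Pi.smul_apply, smul_eq_mul] at h
    rw [← hu] at h
    have hx := hrne x
    rw [← mul_div_assoc, eq_div_iff hx, ← h, Finset.sum_mul]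
    refine Finset.sum_congr rfl fun y _ => ?_
    simp only [div_eq_mul_inv]
    ring
  · intro i j
    have h := orthonormal_iff_ite.1 u.orthonormal i j
    rw [PiLp.inner_apply] at h
    rw [← h]
    refine Finset.sum_congr rfl fun x _ => ?_
    have hx := hrne x
    rw [hr2]
    simp only [RCLike.inner_apply, conj_trivial]
    field_simp
  · intro f x
    have h := u.sum_repr' (WithLp.toLp 2 fun y => r y * f y)
    have h' := congrArg (fun v : EuclideanSpace ℝ S => v x) h
    simp only [PiLp.inner_apply, RCLike.inner_apply, conj_trivial, WithLp.ofLp_sum,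
      Finset.sum_apply, PiLp.smul_apply, smul_eq_mul] at h'
    have hx := hrne x
    rw [← mul_right_inj' hx, ← h', Finset.mul_sum]
    refine Finset.sum_congr rfl fun i _ => ?_
    have : ∑ y, m y * (u i y / r y) * f y = ∑ y, r y * f y * (u i y) := by
      refine Finset.sum_congr rfl fun y _ => ?_
      have hy := hrne y
      rw [hr2]
      field_simp
    rw [this]
    field_simp

/-- The second smallest eigenvalue is at least `a` iff no two eigenvalues are below `a`. -/
theorem le_lambda₂_iff {L : Matrix S S ℝ} {lam : S → ℝ}
    (hlam : L.charpoly.roots = Multiset.map lam Finset.univ.val) (hcard : 2 ≤ Fintype.card S)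
    (a : ℝ) : a ≤ lambda₂ L ↔ ∀ i j, i ≠ j → a ≤ max (lam i) (lam j) := by
  unfold lambda₂
  set l := L.charpoly.roots.sort (· ≤ ·) with hl
  have hcoe : (l : Multiset ℝ) = Multiset.map lam Finset.univ.val := by
    rw [hl, Multiset.sort_eq, hlam]
  have hsort : l.Pairwise (· ≤ ·) := Multiset.pairwise_sort _ _
  have hlen : l.length = Fintype.card S := by
    rw [← Multiset.coe_card, hcoe, Multiset.card_map]; rfl
  have hcount : ∀ b : ℝ, (l.filter (· < b)).length =
      (Finset.univ.filter fun i => lam i < b).card := by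
    intro b
    rw [← Multiset.coe_card, ← Multiset.filter_coe, hcoe, Multiset.filter_map,
      Multiset.card_map]
    rfl
  clear_value l
  -- With two or more states the sorted list has a second entry, so the default `0` of `getD` is
  -- never returned.
  match l, hsort, hlen, hcount with
  | [], _, hlen, _ => simp at hlen; omega
  | [_], _, hlen, _ => simp at hlen; omega
  | b₀ :: b₁ :: t, hsort, _, hcount =>
    simp only [List.pairwise_cons, List.mem_cons, forall_eq_or_imp] at hsort
    obtain ⟨⟨h01, -⟩, h1t, -⟩ := hsort
    change a ≤ b₁ ↔ _
    constructor
    · intro hab i j hij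
      by_contra! hlt
      obtain ⟨hi, hj⟩ := max_lt_iff.1 hlt
      have h := hcount b₁
      have hle : ((b₀ :: b₁ :: t).filter (· < b₁)).length ≤ 1 := by
        rw [List.filter_cons, List.filter_cons_of_neg (by simp),
          List.filter_eq_nil_iff.2 (fun c hc => by simpa using h1t c hc)]
        split_ifs <;> simp
      rw [h, Finset.card_le_one] at hle
      exact hij (hle i (by simpa using hi.trans_le hab) j (by simpa using hj.trans_le hab))
    · intro h
      by_contra! hlt
      have h2 := hcount a
      have hge : 2 ≤ ((b₀ :: b₁ :: t).filter (· < a)).length := by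
        rw [List.filter_cons_of_pos (by simpa using h01.trans_lt hlt),
          List.filter_cons_of_pos (by simpa using hlt)]
        simp
      rw [h2] at hge
      obtain ⟨i, hi, j, hj, hij⟩ := Finset.one_lt_card.1 hge
      simp only [Finset.mem_filter, Finset.mem_univ, true_and] at hi hj
      exact absurd (h i j hij) (not_le.2 (max_lt hi hj))

/-- A Poincaré inequality with constant `a` bounds the second smallest eigenvalue. -/
theorem le_lambda₂_of_poincare {m : S → ℝ} (hm : ∀ x, 0 < m x) {L : Matrix S S ℝ}
    (hL : ∀ x y, m x * L x y = m y * L y x) (hcard : 2 ≤ Fintype.card S) {a : ℝ}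
    (h : ∀ f : S → ℝ, ∑ x, m x * f x = 0 →
      a * ∑ x, m x * f x ^ 2 ≤ ∑ x, m x * f x * ∑ y, L x y * f y) :
    a ≤ lambda₂ L := by
  obtain ⟨lam, φ, hroots, heig, horth, -⟩ := exists_weighted_eigenbasis hm hL
  refine (le_lambda₂_iff hroots hcard a).2 fun i j hij => ?_
  have key : ∀ α β : ℝ, α * ∑ x, m x * φ i x + β * ∑ x, m x * φ j x = 0 →
      a * (α ^ 2 + β ^ 2) ≤ lam i * α ^ 2 + lam j * β ^ 2 := by
    intro α β hαβ
    have hii := horth i i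
    have hjj := horth j j
    have hij' := horth i j
    rw [if_pos rfl] at hii hjj
    rw [if_neg hij] at hij'
    have h0 := h (fun x => α * φ i x + β * φ j x) (by
      rw [← hαβ, Finset.mul_sum, Finset.mul_sum, ← Finset.sum_add_distrib]
      exact Finset.sum_congr rfl fun x _ => by ring)
    have h1 : ∑ x, m x * (α * φ i x + β * φ j x) ^ 2 = α ^ 2 + β ^ 2 := by
      calc _ = α ^ 2 * ∑ x, m x * φ i x * φ i x + β ^ 2 * ∑ x, m x * φ j x * φ j x +
            2 * α * β * ∑ x, m x * φ i x * φ j x := by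
            simp only [Finset.mul_sum, ← Finset.sum_add_distrib]
            exact Finset.sum_congr rfl fun x _ => by ring
        _ = _ := by rw [hii, hjj, hij']; ring
    have h2 : ∑ x, m x * (α * φ i x + β * φ j x) * ∑ y, L x y * (α * φ i y + β * φ j y) =
        lam i * α ^ 2 + lam j * β ^ 2 := by
      calc _ = ∑ x, m x * (α * φ i x + β * φ j x) *
              (α * (lam i * φ i x) + β * (lam j * φ j x)) := by
            refine Finset.sum_congr rfl fun x _ => ?_
            rw [← heig, ← heig]
            congr 1
            rw [Finset.mul_sum, Finset.mul_sum, ← Finset.sum_add_distrib]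
            exact Finset.sum_congr rfl fun y _ => by ring
        _ = lam i * α ^ 2 * ∑ x, m x * φ i x * φ i x +
            lam j * β ^ 2 * ∑ x, m x * φ j x * φ j x +
            (α * β * lam i + α * β * lam j) * ∑ x, m x * φ i x * φ j x := by
            simp only [Finset.mul_sum, ← Finset.sum_add_distrib]
            exact Finset.sum_congr rfl fun x _ => by ring
        _ = _ := by rw [hii, hjj, hij']; ring
    rwa [h1, h2] at h0
  by_contra! hlt
  obtain ⟨hi, hj⟩ := max_lt_iff.1 hlt
  -- In the span of two eigenvectors some nonzero combination has mean zero. The coefficients chosen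
  -- here may both vanish; in that case `φ i` itself has mean zero.
  have hk := key (∑ x, m x * φ j x) (-∑ x, m x * φ i x) (by ring)
  by_cases hz : ∑ x, m x * φ i x = 0
  · have := key 1 0 (by rw [hz]; ring)
    linarith
  · have hp : 0 < (∑ x, m x * φ i x) ^ 2 := by positivity
    nlinarith [sq_nonneg (∑ x, m x * φ j x)]

/-- A positive lower bound on the second smallest eigenvalue of a matrix with vanishing row sums
gives a Poincaré inequality. -/
theorem poincare_of_le_lambda₂ {m : S → ℝ} (hm : ∀ x, 0 < m x) {L : Matrix S S ℝ}
    (hL : ∀ x y, m x * L x y = m y * L y x) (hrow : ∀ x, ∑ y, L x y = 0)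
    (hcard : 2 ≤ Fintype.card S) {a : ℝ} (ha : 0 < a) (hgap : a ≤ lambda₂ L)
    (f : S → ℝ) (hf : ∑ x, m x * f x = 0) :
    a * ∑ x, m x * f x ^ 2 ≤ ∑ x, m x * f x * ∑ y, L x y * f y := by
  obtain ⟨lam, φ, hroots, heig, horth, hbasis⟩ := exists_weighted_eigenbasis hm hL
  have hmax := (le_lambda₂_iff hroots hcard a).1 hgap
  set d : S → ℝ := fun i => ∑ y, m y * φ i y * f y with hd
  set c : S → ℝ := fun i => ∑ x, m x * φ i x with hc
  have hexp : ∀ x, f x = ∑ i, d i * φ i x := hbasis f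
  have hone : ∀ x : S, (1 : ℝ) = ∑ i, c i * φ i x := fun x => by
    simpa only [mul_one] using hbasis (fun _ => 1) x
  -- The constant function lies in the kernel of `L`, so it has components only along the eigenvalue
  -- `0`.
  have hlc : ∀ i, lam i * c i = 0 := by
    intro i
    calc lam i * c i = ∑ x, ∑ y, m x * L x y * φ i y := by
          rw [hc, Finset.mul_sum]
          refine Finset.sum_congr rfl fun x _ => ?_
          rw [mul_left_comm, ← heig, Finset.mul_sum]
          exact Finset.sum_congr rfl fun y _ => by ring
      _ = ∑ y, m y * φ i y * ∑ x, L y x := by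
          rw [Finset.sum_comm]
          refine Finset.sum_congr rfl fun y _ => ?_
          rw [Finset.mul_sum]
          exact Finset.sum_congr rfl fun x _ => by rw [hL]; ring
      _ = 0 := by simp [hrow]
  have hdc : ∑ i, d i * c i = 0 := by
    rw [← hf]
    simp_rw [hc, Finset.mul_sum]
    rw [Finset.sum_comm]
    refine Finset.sum_congr rfl fun x _ => ?_
    rw [hexp x, Finset.mul_sum]
    exact Finset.sum_congr rfl fun i _ => by ring
  have hnorm : ∑ x, m x * f x ^ 2 = ∑ i, d i ^ 2 := by
    calc ∑ x, m x * f x ^ 2 = ∑ x, ∑ i, d i * (m x * φ i x * f x) := by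
          refine Finset.sum_congr rfl fun x _ => ?_
          rw [sq]
          nth_rw 1 [hexp x]
          rw [Finset.sum_mul, Finset.mul_sum]
          exact Finset.sum_congr rfl fun i _ => by ring
      _ = _ := by
          rw [Finset.sum_comm]
          refine Finset.sum_congr rfl fun i _ => ?_
          rw [← Finset.mul_sum, sq]
  have hform : ∑ x, m x * f x * ∑ y, L x y * f y = ∑ i, lam i * d i ^ 2 := by
    calc ∑ x, m x * f x * ∑ y, L x y * f y
        = ∑ x, ∑ i, lam i * d i * (m x * φ i x * f x) := by
          refine Finset.sum_congr rfl fun x _ => ?_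
          have : ∑ y, L x y * f y = ∑ i, d i * (lam i * φ i x) := by
            calc ∑ y, L x y * f y = ∑ y, ∑ i, d i * (L x y * φ i y) := by
                  refine Finset.sum_congr rfl fun y _ => ?_
                  rw [hexp y, Finset.mul_sum]
                  exact Finset.sum_congr rfl fun i _ => by ring
              _ = _ := by
                  rw [Finset.sum_comm]
                  refine Finset.sum_congr rfl fun i _ => ?_
                  rw [← Finset.mul_sum, heig]
          rw [this, Finset.mul_sum]
          exact Finset.sum_congr rfl fun i _ => by ring
      _ = _ := by
          rw [Finset.sum_comm]
          refine Finset.sum_congr rfl fun i _ => ?_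
          rw [← Finset.mul_sum]
          ring
  rw [hnorm, hform, Finset.mul_sum]
  refine Finset.sum_le_sum fun i _ => ?_
  by_cases hi : a ≤ lam i
  · exact mul_le_mul_of_nonneg_right hi (sq_nonneg _)
  · push Not at hi
    -- All other eigenvalues are at least `a > 0`, so the constants are multiples of `φ i`; being of
    -- mean zero, `f` has no component along it.
    have hcj : ∀ j, j ≠ i → c j = 0 := by
      intro j hj
      have h1 := hmax i j hj.symm
      have h2 : a ≤ lam j := (le_max_iff.1 h1).resolve_left (not_le.2 hi)
      exact (mul_eq_zero.1 (hlc j)).resolve_left (ha.trans_le h2).ne'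
    have h1 := hone i
    rw [Finset.sum_eq_single i (fun j _ hj => by rw [hcj j hj, zero_mul]) (by simp)] at h1
    rw [Finset.sum_eq_single i (fun j _ hj => by rw [hcj j hj, mul_zero]) (by simp)] at hdc
    have hci : c i ≠ 0 := fun h => by rw [h, zero_mul] at h1; exact one_ne_zero h1
    rw [(mul_eq_zero.1 hdc).resolve_right hci]
    simp

end Spectral

/-- The Dirichlet form of a reversible generator as a sum over steps. -/
theorem dirichlet_form_eq {S : Type*} [Fintype S] {m : S → ℝ} {L : Matrix S S ℝ}
    (hL : ∀ x y, m x * L x y = m y * L y x) (hrow : ∀ x, ∑ y, L x y = 0) (f : S → ℝ) :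
    ∑ x, m x * f x * ∑ y, (-L) x y * f y =
      2⁻¹ * ∑ x, ∑ y, m x * L x y * (f x - f y) ^ 2 := by
  have h1 : ∑ x, ∑ y, m x * L x y * f x ^ 2 = 0 := by
    refine Finset.sum_eq_zero fun x _ => ?_
    calc _ = m x * f x ^ 2 * ∑ y, L x y := by
          rw [Finset.mul_sum]; exact Finset.sum_congr rfl fun y _ => by ring
      _ = 0 := by rw [hrow, mul_zero]
  have h2 : ∑ x, ∑ y, m x * L x y * f y ^ 2 = 0 := by
    rw [Finset.sum_comm, ← h1]
    exact Finset.sum_congr rfl fun x _ => Finset.sum_congr rfl fun y _ => by rw [hL]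
  have h3 : ∑ x, m x * f x * ∑ y, (-L) x y * f y = - ∑ x, ∑ y, m x * L x y * (f x * f y) := by
    rw [← Finset.sum_neg_distrib]
    refine Finset.sum_congr rfl fun x _ => ?_
    rw [Finset.mul_sum, ← Finset.sum_neg_distrib]
    exact Finset.sum_congr rfl fun y _ => by rw [Matrix.neg_apply]; ring
  have h4 : ∑ x, ∑ y, m x * L x y * (f x - f y) ^ 2 =
      ∑ x, ∑ y, m x * L x y * f x ^ 2 + ∑ x, ∑ y, m x * L x y * f y ^ 2 -
        2 * ∑ x, ∑ y, m x * L x y * (f x * f y) := by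
    simp only [Finset.mul_sum, ← Finset.sum_add_distrib, ← Finset.sum_sub_distrib]
    exact Finset.sum_congr rfl fun x _ => Finset.sum_congr rfl fun y _ => by ring
  rw [h3, h4, h1, h2]
  ring

/-! ### Paths, elevations and the constants of the landscape -/

section Proposal

variable {S : Type*} [Fintype S] {Q : Matrix S S ℝ} {π U : S → ℝ}

theorem IsProposal.ne_of_pos (hQ : IsProposal Q π) {x y : S} (h : 0 < Q x y) : x ≠ y := by
  classical
  rintro rfl
  have h1 := hQ.row_sum x
  rw [← Finset.add_sum_erase _ _ (Finset.mem_univ x)] at h1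
  have h2 : 0 ≤ ∑ y ∈ Finset.univ.erase x, Q x y :=
    Finset.sum_nonneg fun y hy => hQ.off_diag_nonneg x y (Finset.ne_of_mem_erase hy).symm
  linarith

/-- Detailed balance carries positivity of `π` along each step of a path. -/
theorem IsProposal.prob_pos (hQ : IsProposal Q π) (x : S) : 0 < π x := by
  obtain ⟨x₀, hx₀⟩ : ∃ x₀, 0 < π x₀ := by
    by_contra! h
    have : ∑ x, π x ≤ 0 := Finset.sum_nonpos fun x _ => h x
    rw [hQ.prob_sum] at this
    linarith
  by_cases hx : x₀ = x
  · rwa [← hx]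
  obtain ⟨γ⟩ := hQ.irreducible x₀ x hx
  have h : ∀ i, 0 < π (γ.vertex i) := by
    intro i
    induction i using Fin.induction with
    | zero => rwa [γ.source]
    | succ i ih =>
      refine lt_of_le_of_ne (hQ.prob_nonneg _) fun h0 => ?_
      have h1 := hQ.detailed_balance (γ.vertex i.castSucc) (γ.vertex i.succ)
      rw [← h0, zero_mul] at h1
      exact (mul_pos ih (γ.edge i)).ne' h1
  simpa only [γ.target] using h (Fin.last _)

theorem IsProposal.nonempty (hQ : IsProposal Q π) : Nonempty S := by
  by_contra h
  rw [not_nonempty_iff] at h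
  simpa using hQ.prob_sum

/-- There may be infinitely many paths, but an elevation is a minimum of two values of `U`, or `0`
(the empty supremum) for a path with no step. Hence the infimum in `H₂` is attained. -/
theorem finite_range_elev₂ (U : S → ℝ) (x y : S) :
    (Set.range fun γ : QPath Q x y => elev₂ U γ).Finite := by
  refine ((Set.finite_range fun p : S × S => min (U p.1) (U p.2)).insert 0).subset ?_
  rintro _ ⟨γ, rfl⟩
  rcases isEmpty_or_nonempty (Fin γ.length) with h | h
  · left
    exact Real.iSup_of_isEmpty _
  · right
    obtain ⟨i, hi⟩ := exists_eq_ciSup_of_finite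
      (f := fun i : Fin γ.length => min (U (γ.vertex i.castSucc)) (U (γ.vertex i.succ)))
    exact ⟨(γ.vertex i.castSucc, γ.vertex i.succ), hi⟩

theorem exists_elev₂_eq_H₂ (U : S → ℝ) {x y : S} (h : Nonempty (QPath Q x y)) :
    ∃ γ : QPath Q x y, elev₂ U γ = H₂ Q U x y :=
  (Set.range_nonempty _).csInf_mem (finite_range_elev₂ U x y)

theorem exists_isOptimal (hQ : IsProposal Q π) (U : S → ℝ) :
    ∃ γ : ∀ x y : S, QPath Q x y, IsOptimal U γ := by
  have h : ∀ x y : S, ∃ γ : QPath Q x y, x ≠ y → elev₂ U γ = H₂ Q U x y := by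
    intro x y
    by_cases hxy : x = y
    · subst hxy
      exact ⟨⟨0, fun _ => x, rfl, rfl, fun i => i.elim0⟩, fun h => absurd rfl h⟩
    · obtain ⟨γ, hγ⟩ := exists_elev₂_eq_H₂ U (hQ.irreducible x y hxy)
      exact ⟨γ, fun _ => hγ⟩
  choose γ hγ using h
  exact ⟨γ, hγ⟩

theorem le_c₂ {x y : S} (hxy : x ≠ y) : H₂ Q U x y - U x - U y ≤ c₂ Q U :=
  le_ciSup (f := fun p : {p : S × S // p.1 ≠ p.2} => H₂ Q U p.1.1 p.1.2 - U p.1.1 - U p.1.2)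
    (Set.finite_range _).bddAbove ⟨(x, y), hxy⟩

/-- This also rules out a one-point space, where the supremum over no pairs is `0`. -/
theorem exists_lt_H₂_of_c₂_pos (hc : 0 < c₂ Q U) :
    ∃ x y : S, x ≠ y ∧ U x + U y < H₂ Q U x y := by
  by_contra! h
  refine not_le.2 hc (Real.iSup_nonpos fun p => ?_)
  have := h p.1.1 p.1.2 p.2
  linarith

theorem nonneg_of_iInf_eq_zero (hU : ⨅ x, U x = 0) (x : S) : 0 ≤ U x :=
  hU ▸ ciInf_le (Set.finite_range U).bddBelow x

theorem mem_Umin_iff (hU : ⨅ x, U x = 0) (x : S) : x ∈ Umin U ↔ U x = 0 := by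
  rw [Umin, hU, Set.mem_ofPred_eq]

theorem constR_eq (hU : ⨅ x, U x = 0) : constR U = ⨆ x, U x := by
  rw [constR, hU, sub_zero]

theorem le_constR (hU : ⨅ x, U x = 0) (x : S) : U x ≤ constR U := by
  rw [constR_eq hU]
  exact le_ciSup (Set.finite_range U).bddAbove x

theorem constR_pos (hQ : IsProposal Q π) (hU : ⨅ x, U x = 0) (hc : 0 < c₂ Q U) :
    0 < constR U := by
  obtain ⟨x, y, hxy, h⟩ := exists_lt_H₂_of_c₂_pos hc
  obtain ⟨γ, hγ⟩ := exists_elev₂_eq_H₂ U (hQ.irreducible x y hxy)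
  have hR : 0 ≤ constR U := (nonneg_of_iInf_eq_zero hU x).trans (le_constR hU x)
  have : elev₂ U γ ≤ constR U :=
    Real.iSup_le (fun i => (min_le_left _ _).trans (le_constR hU _)) hR
  linarith [nonneg_of_iInf_eq_zero hU x, nonneg_of_iInf_eq_zero hU y]

theorem exists_notMem_Umin (hU : ⨅ x, U x = 0) (hR : 0 < constR U) : ∃ x, x ∉ Umin U := by
  by_contra! h
  refine not_le.2 hR ?_
  rw [constR_eq hU]
  exact Real.iSup_nonpos fun x => ((mem_Umin_iff hU x).1 (h x)).le

theorem constB_le (hU : ⨅ x, U x = 0) {x : S} (hx : x ∉ Umin U) : constB U ≤ U x := by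
  rw [constB, hU, sub_zero]
  exact csInf_le (Set.toFinite _).bddBelow ⟨x, hx, rfl⟩

theorem constB_le_constR (hU : ⨅ x, U x = 0) (hR : 0 < constR U) : constB U ≤ constR U := by
  obtain ⟨x, hx⟩ := exists_notMem_Umin hU hR
  exact (constB_le hU hx).trans (le_constR hU x)

theorem massMin_pos (hQ : IsProposal Q π) : 0 < massMin π U := by
  have := hQ.nonempty
  obtain ⟨x, hx⟩ := exists_eq_ciInf_of_finite (f := U)
  classical
  exact Finset.sum_pos (fun x _ => hQ.prob_pos x) ⟨x, Finset.mem_filter.2 ⟨Finset.mem_univ x, hx⟩⟩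

end Proposal

/-! ### Gibbs weights and reversibility of `M₂` -/

/-- The unnormalized Gibbs weight at temperature `τ`. For `τ = 0` it is `π`, the value at infinite
temperature. -/
def gibbsWeight {S : Type*} (π U : S → ℝ) (τ : ℝ) (x : S) : ℝ := π x * Real.exp (-U x / τ)

section Gen

variable {S : Type*} [Fintype S] {Q : Matrix S S ℝ} {π U : S → ℝ} {τ : ℝ}

theorem gibbsWeight_pos (hQ : IsProposal Q π) (x : S) : 0 < gibbsWeight π U τ x :=
  mul_pos (hQ.prob_pos x) (Real.exp_pos _)

/-- The weight is `π` on `U_min` because `U = 0` there. This bound, uniform in `τ`, is the source of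
`π(U_min)` in `A`. -/
theorem massMin_le_sum_gibbsWeight (hQ : IsProposal Q π) (hU : ⨅ x, U x = 0) :
    massMin π U ≤ ∑ x, gibbsWeight π U τ x := by
  classical
  unfold massMin
  calc _ = ∑ x ∈ Finset.univ.filter (fun x => x ∈ Umin U), gibbsWeight π U τ x := by
        refine Finset.sum_congr (by congr) fun x hx => ?_
        simp only [Finset.mem_filter, Finset.mem_univ, true_and, mem_Umin_iff hU] at hx
        simp [gibbsWeight, hx]
    _ ≤ _ := Finset.sum_le_sum_of_subset_of_nonneg (Finset.filter_subset _ _)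
        fun x _ _ => (gibbsWeight_pos hQ x).le

variable [DecidableEq S]

theorem gen₂_apply_ne {x y : S} (h : x ≠ y) :
    gen₂ Q U τ x y = Q x y * max 1 (Real.exp ((U x - U y) / τ)) := by
  simp [gen₂, h]

theorem gen₂_row_sum (x : S) : ∑ y, gen₂ Q U τ x y = 0 := by
  rw [← Finset.add_sum_erase _ _ (Finset.mem_univ x)]
  have h1 : gen₂ Q U τ x x = -∑ y ∈ Finset.univ.erase x, gen₂ Q U τ x y := by
    simp only [gen₂, Matrix.of_apply, if_true]
    rw [Finset.filter_ne' Finset.univ x]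
    congr 1
    exact Finset.sum_congr rfl fun y hy => by rw [if_neg (Finset.ne_of_mem_erase hy).symm]
  rw [h1, neg_add_cancel]

/-- The maximum in `M₂` turns `e^{-U(x)/τ}` into the larger of the two Boltzmann factors. The result
is symmetric in `x` and `y`, and it explains why elevations are measured by `min`. -/
theorem gibbsWeight_mul_gen₂ (hτ : 0 ≤ τ) {x y : S} (h : x ≠ y) :
    gibbsWeight π U τ x * gen₂ Q U τ x y =
      π x * Q x y * Real.exp (-min (U x) (U y) / τ) := by
  rw [gen₂_apply_ne h, gibbsWeight]
  have : Real.exp (-min (U x) (U y) / τ) =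
      Real.exp (-U x / τ) * max 1 (Real.exp ((U x - U y) / τ)) := by
    rw [mul_max_of_nonneg _ _ (Real.exp_pos _).le, mul_one, ← Real.exp_add, ← add_div,
      ← Real.exp_monotone.map_max]
    congr 1
    rw [max_div_div_right hτ]
    congr 1
    rw [show -U x + (U x - U y) = -U y by ring, max_neg_neg]
  rw [this]
  ring

theorem gibbsWeight_gen₂_symm (hQ : IsProposal Q π) (hτ : 0 ≤ τ) (x y : S) :
    gibbsWeight π U τ x * gen₂ Q U τ x y = gibbsWeight π U τ y * gen₂ Q U τ y x := by
  by_cases h : x = y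
  · rw [h]
  · rw [gibbsWeight_mul_gen₂ hτ h, gibbsWeight_mul_gen₂ hτ (Ne.symm h), min_comm,
      hQ.detailed_balance]

theorem gibbsWeight_mul_gen₂_nonneg (hQ : IsProposal Q π) (hτ : 0 ≤ τ) {x y : S} (h : x ≠ y) :
    0 ≤ gibbsWeight π U τ x * gen₂ Q U τ x y := by
  rw [gibbsWeight_mul_gen₂ hτ h]
  exact mul_nonneg (mul_nonneg (hQ.prob_nonneg x) (hQ.off_diag_nonneg x y h)) (Real.exp_pos _).le

end Gen

/-! ### Canonical paths and the spectral gap -/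

section Path

variable {S : Type*} [Fintype S] {Q : Matrix S S ℝ} {π U : S → ℝ}

/-- The increment of a function along a sequence is bounded by the sum of its increments over the
distinct steps of the sequence. -/
theorem abs_sub_le_sum_image_steps {S : Type*} [DecidableEq S] (f : S → ℝ) (v : ℕ → S) (n : ℕ) :
    ∀ j ≤ n, |f (v 0) - f (v j)| ≤
      ∑ e ∈ (Finset.range n).image (fun i => (v i, v (i + 1))), |f e.1 - f e.2| := by
  induction n with
  | zero => intro j hj; simp [Nat.le_zero.1 hj]
  | succ n ih =>
    intro j hj
    rw [Finset.range_add_one, Finset.image_insert]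
    set E := (Finset.range n).image (fun i => (v i, v (i + 1))) with hE
    rcases Nat.le_succ_iff.1 hj with hj | rfl
    · exact (ih j hj).trans (Finset.sum_le_sum_of_subset_of_nonneg (Finset.subset_insert _ _)
        fun _ _ _ => abs_nonneg _)
    -- A repeated step ends at a vertex already reached earlier, so the bound for that earlier index
    -- applies; this is why the induction covers every `j ≤ n`.
    · by_cases hmem : (v n, v (n + 1)) ∈ E
      · rw [Finset.insert_eq_of_mem hmem]
        obtain ⟨i, hi, hie⟩ := Finset.mem_image.1 hmem
        rw [← (Prod.mk.inj hie).2]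
        exact ih (i + 1) (Finset.mem_range.1 hi)
      · rw [Finset.sum_insert hmem]
        have h1 := ih n le_rfl
        have h2 := abs_sub_le (f (v 0)) (f (v n)) (f (v (n + 1)))
        dsimp only
        linarith

theorem chi_nonneg {x y : S} (γ : QPath Q x y) (z w : S) : 0 ≤ chi γ z w := by
  unfold chi; split_ifs <;> norm_num

/-- Cauchy–Schwarz over the distinct steps, of which there are at most `γ.length`. Steps must be
counted once because `chi` is an indicator. -/
theorem sq_sub_le_length_mul_sum_chi {x y : S} (γ : QPath Q x y) (f : S → ℝ) :
    (f x - f y) ^ 2 ≤ γ.length * ∑ z, ∑ w, chi γ z w * (f z - f w) ^ 2 := by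
  classical
  -- The path is extended to all of `ℕ` by stopping at its last vertex.
  set v : ℕ → S := fun i => γ.vertex ⟨min i γ.length, by omega⟩ with hv
  set E := (Finset.range γ.length).image (fun i => (v i, v (i + 1))) with hE
  have hcs : ∀ i : Fin γ.length, v i = γ.vertex i.castSucc ∧ v (i + 1) = γ.vertex i.succ := by
    intro i
    have := i.2
    constructor <;> simp only [hv] <;> congr 1 <;> ext <;> simp
  have hmem : ∀ z w, (z, w) ∈ E ↔
      ∃ i : Fin γ.length, γ.vertex i.castSucc = z ∧ γ.vertex i.succ = w := by
    intro z w
    rw [hE, Finset.mem_image]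
    constructor
    · rintro ⟨i, hi, hie⟩
      have hi' := Finset.mem_range.1 hi
      obtain ⟨h1, h2⟩ := Prod.mk.inj hie
      obtain ⟨h3, h4⟩ := hcs ⟨i, hi'⟩
      exact ⟨⟨i, hi'⟩, h3.symm.trans h1, h4.symm.trans h2⟩
    · rintro ⟨i, h1, h2⟩
      obtain ⟨h3, h4⟩ := hcs i
      exact ⟨i, Finset.mem_range.2 i.2, by rw [h3, h4, h1, h2]⟩
  have hv0 : v 0 = x := by
    refine Eq.trans ?_ γ.source
    simp only [hv]
    congr 1
  have hvn : v γ.length = y := by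
    refine Eq.trans ?_ γ.target
    simp only [hv]
    congr 1
    ext
    simp
  have h1 := abs_sub_le_sum_image_steps f v γ.length γ.length le_rfl
  rw [hv0, hvn, ← hE] at h1
  have h2 : ∑ z, ∑ w, chi γ z w * (f z - f w) ^ 2 = ∑ e ∈ E, |f e.1 - f e.2| ^ 2 := by
    rw [← Fintype.sum_prod_type' fun z w => chi γ z w * (f z - f w) ^ 2,
      ← Finset.sum_subset (Finset.subset_univ E)]
    · refine Finset.sum_congr rfl fun e he => ?_
      rw [chi, if_pos ((hmem e.1 e.2).1 he), one_mul, sq_abs]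
    · intro e _ he
      rw [chi, if_neg (fun h => he ((hmem e.1 e.2).2 h)), zero_mul]
  rw [h2, ← sq_abs]
  calc |f x - f y| ^ 2 ≤ (∑ e ∈ E, |f e.1 - f e.2|) ^ 2 :=
        pow_le_pow_left₀ (abs_nonneg _) h1 2
    _ ≤ E.card * ∑ e ∈ E, |f e.1 - f e.2| ^ 2 := sq_sum_le_card_mul_sum_sq
    _ ≤ _ := by
        refine mul_le_mul_of_nonneg_right ?_ (Finset.sum_nonneg fun _ _ => sq_nonneg _)
        exact_mod_cast Finset.card_image_le.trans (Finset.card_range _).le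

theorem pos_and_min_le_of_chi_ne_zero {x y : S} (γ : QPath Q x y) {z w : S}
    (h : chi γ z w ≠ 0) : chi γ z w = 1 ∧ 0 < Q z w ∧ min (U z) (U w) ≤ elev₂ U γ := by
  by_cases hex : ∃ i : Fin γ.length, γ.vertex i.castSucc = z ∧ γ.vertex i.succ = w
  · refine ⟨if_pos hex, ?_⟩
    obtain ⟨i, rfl, rfl⟩ := hex
    exact ⟨γ.edge i, le_ciSup (f := fun i : Fin γ.length =>
      min (U (γ.vertex i.castSucc)) (U (γ.vertex i.succ))) (Set.finite_range _).bddAbove i⟩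
  · exact absurd (if_neg hex) h

/-- The load of the step from `z` to `w` under a choice of paths. -/
def stepLoad (π U : S → ℝ) (γ : ∀ x y : S, QPath Q x y) (q : S × S) : ℝ :=
  ∑ x, ∑ y, chi (γ x y) q.1 q.2 / (π q.1 * Q q.1 q.2) * (π x * π y / massMin π U)

/-- The largest length of a chosen path. -/
def maxLength (γ : ∀ x y : S, QPath Q x y) : ℕ :=
  Finset.univ.sup fun p : S × S => (γ p.1 p.2).length

theorem pathA_eq (γ : ∀ x y : S, QPath Q x y) :
    pathA π U γ = (maxLength γ * ⨆ q, stepLoad π U γ q)⁻¹ := rfl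

theorem length_le_maxLength (γ : ∀ x y : S, QPath Q x y) (x y : S) :
    (γ x y).length ≤ maxLength γ :=
  Finset.le_sup (f := fun p : S × S => (γ p.1 p.2).length) (Finset.mem_univ (x, y))

/-- A diagonal entry `Q z z` may be negative, but no path makes such a step, so `chi` vanishes
there. -/
theorem stepLoad_term_nonneg (hQ : IsProposal Q π) (γ : ∀ x y : S, QPath Q x y) (z w x y : S) :
    0 ≤ chi (γ x y) z w / (π z * Q z w) * (π x * π y / massMin π U) := by
  refine mul_nonneg ?_ (div_nonneg (mul_nonneg (hQ.prob_nonneg x) (hQ.prob_nonneg y))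
    (massMin_pos hQ).le)
  by_cases h : chi (γ x y) z w = 0
  · simp [h]
  · obtain ⟨h1, h2, -⟩ := pos_and_min_le_of_chi_ne_zero (U := U) (γ x y) h
    exact div_nonneg (chi_nonneg _ _ _) (mul_nonneg (hQ.prob_nonneg z) h2.le)

theorem stepLoad_le_iSup (γ : ∀ x y : S, QPath Q x y) (q : S × S) :
    stepLoad π U γ q ≤ ⨆ q, stepLoad π U γ q :=
  le_ciSup (Set.finite_range _).bddAbove q

theorem pathA_pos (hQ : IsProposal Q π) (γ : ∀ x y : S, QPath Q x y) {x y : S} (hxy : x ≠ y) :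
    0 < pathA π U γ := by
  have hlen : 0 < (γ x y).length := by
    by_contra h
    have h0 : Fin.last (γ x y).length = 0 := by
      ext
      simp only [Fin.val_last, Fin.val_zero]
      omega
    have h1 := (γ x y).target
    rw [h0, (γ x y).source] at h1
    exact hxy h1
  rw [pathA_eq]
  refine inv_pos.2 (mul_pos (by exact_mod_cast hlen.trans_le (length_le_maxLength γ x y)) ?_)
  set i : Fin (γ x y).length := ⟨0, hlen⟩
  set q : S × S := ((γ x y).vertex i.castSucc, (γ x y).vertex i.succ) with hq
  refine lt_of_lt_of_le ?_ (stepLoad_le_iSup γ q)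
  have hchi : chi (γ x y) q.1 q.2 = 1 := if_pos ⟨i, rfl, rfl⟩
  refine Finset.sum_pos' (fun x _ => Finset.sum_nonneg fun y _ =>
    stepLoad_term_nonneg hQ γ q.1 q.2 x y) ⟨x, Finset.mem_univ _,
      Finset.sum_pos' (fun y _ => stepLoad_term_nonneg hQ γ q.1 q.2 x y)
        ⟨y, Finset.mem_univ _, ?_⟩⟩
  rw [hchi]
  exact mul_pos (div_pos one_pos (mul_pos (hQ.prob_pos _) ((γ x y).edge i)))
    (div_pos (mul_pos (hQ.prob_pos x) (hQ.prob_pos y)) (massMin_pos hQ))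

variable [DecidableEq S]

/-- The inequality `min(U(z),U(w)) - U(x) - U(y) ≤ c₂` on an optimal path compares the exponentials;
the factor `Z / π(U_min) ≥ 1` is inserted so that `Z` cancels against the variance later. -/
theorem chi_mul_gibbsWeight_le (hQ : IsProposal Q π) (hU : ⨅ x, U x = 0) {τ : ℝ} (hτ : 0 < τ)
    {γ : ∀ x y : S, QPath Q x y} (hγ : IsOptimal U γ) {x y : S} (hxy : x ≠ y) (z w : S) :
    chi (γ x y) z w * (gibbsWeight π U τ x * gibbsWeight π U τ y) ≤
      chi (γ x y) z w / (π z * Q z w) * (π x * π y / massMin π U) *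
        (Real.exp (c₂ Q U / τ) * (∑ x, gibbsWeight π U τ x) *
          (gibbsWeight π U τ z * gen₂ Q U τ z w)) := by
  by_cases h : chi (γ x y) z w = 0
  · simp [h]
  obtain ⟨h1, h2, h3⟩ := pos_and_min_le_of_chi_ne_zero (U := U) (γ x y) h
  rw [hγ x y hxy] at h3
  have hc := le_c₂ (Q := Q) (U := U) hxy
  rw [h1, gibbsWeight_mul_gen₂ hτ.le (hQ.ne_of_pos h2)]
  have hM := massMin_pos (U := U) hQ
  have hZ := massMin_le_sum_gibbsWeight (τ := τ) hQ hU
  have hz := hQ.prob_pos z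
  have hx := hQ.prob_pos x
  have hy := hQ.prob_pos y
  set Z := ∑ x, gibbsWeight π U τ x
  have hexp : Real.exp (-U x / τ) * Real.exp (-U y / τ) ≤
      Real.exp (c₂ Q U / τ) * Real.exp (-min (U z) (U w) / τ) := by
    rw [← Real.exp_add, ← Real.exp_add, ← add_div, ← add_div]
    refine Real.exp_le_exp.2 ((div_le_div_iff_of_pos_right hτ).2 ?_)
    linarith
  calc 1 * (gibbsWeight π U τ x * gibbsWeight π U τ y)
      = π x * π y * (Real.exp (-U x / τ) * Real.exp (-U y / τ)) := by
        unfold gibbsWeight; ring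
    _ ≤ π x * π y * (Real.exp (c₂ Q U / τ) * Real.exp (-min (U z) (U w) / τ)) := by gcongr
    _ ≤ π x * π y * (Real.exp (c₂ Q U / τ) * Real.exp (-min (U z) (U w) / τ)) *
          (Z / massMin π U) :=
        le_mul_of_one_le_right (by positivity) ((one_le_div hM).2 hZ)
    _ = _ := by field_simp

theorem isGapConstant_pathA (hQ : IsProposal Q π) (hU : ⨅ x, U x = 0) (hc : 0 < c₂ Q U)
    {γ : ∀ x y : S, QPath Q x y} (hγ : IsOptimal U γ) :
    IsGapConstant Q U (pathA π U γ) := by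
  obtain ⟨x₀, y₀, hne, -⟩ := exists_lt_H₂_of_c₂_pos hc
  have hA := pathA_pos (U := U) hQ γ hne
  have hcard : 2 ≤ Fintype.card S := Fintype.one_lt_card_iff.2 ⟨x₀, y₀, hne⟩
  refine ⟨hA, fun τ hτ => ?_⟩
  set m := gibbsWeight π U τ with hm
  have hmpos : ∀ x, 0 < m x := gibbsWeight_pos hQ
  set k : S → S → ℝ := fun z w => m z * gen₂ Q U τ z w with hk
  have hsymm : ∀ x y, m x * gen₂ Q U τ x y = m y * gen₂ Q U τ y x :=
    gibbsWeight_gen₂_symm hQ hτ.le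
  refine le_lambda₂_of_poincare hmpos (fun x y => ?_) hcard fun f hf => ?_
  · rw [Matrix.neg_apply, Matrix.neg_apply, mul_neg, mul_neg, hsymm]
  rw [dirichlet_form_eq hsymm gen₂_row_sum]
  set Z := ∑ x, m x with hZ
  have hZpos : 0 < Z := (massMin_pos hQ).trans_le (massMin_le_sum_gibbsWeight hQ hU)
  set N : ℝ := (maxLength γ : ℝ) with hN
  set T := ⨆ q, stepLoad π U γ q with hT
  set D := ∑ z, ∑ w, k z w * (f z - f w) ^ 2 with hD
  set e := Real.exp (c₂ Q U / τ) with he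
  have hkn : ∀ z w, 0 ≤ k z w * (f z - f w) ^ 2 := by
    intro z w
    by_cases hzw : z = w
    · simp [hzw]
    · exact mul_nonneg (gibbsWeight_mul_gen₂_nonneg hQ hτ.le hzw) (sq_nonneg _)
  -- The variance as a sum over pairs; the cross term vanishes because `f` has mean zero.
  have hvar : ∑ x, ∑ y, m x * m y * (f x - f y) ^ 2 = 2 * Z * ∑ x, m x * f x ^ 2 := by
    have h1 : ∑ x, ∑ y, m x * m y * (f x - f y) ^ 2 = (∑ x, m x * f x ^ 2) * Z +
        Z * ∑ x, m x * f x ^ 2 - 2 * ((∑ x, m x * f x) * ∑ x, m x * f x) := by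
      rw [hZ, Finset.sum_mul_sum, Finset.sum_mul_sum, Finset.sum_mul_sum]
      simp only [Finset.mul_sum, ← Finset.sum_add_distrib,
        ← Finset.sum_sub_distrib]
      exact Finset.sum_congr rfl fun x _ => Finset.sum_congr rfl fun y _ => by ring
    rw [h1, hf]
    ring
  have hpair : ∀ x y, m x * m y * (f x - f y) ^ 2 ≤
      N * (e * Z) * ∑ z, ∑ w, chi (γ x y) z w / (π z * Q z w) * (π x * π y / massMin π U) *
        (k z w * (f z - f w) ^ 2) := by
    intro x y
    by_cases hxy : x = y
    · subst hxy
      rw [sub_self, zero_pow two_ne_zero, mul_zero]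
      refine mul_nonneg (by positivity) (Finset.sum_nonneg fun z _ => Finset.sum_nonneg fun w _ =>
        mul_nonneg (stepLoad_term_nonneg hQ γ z w x x) (hkn z w))
    · have hlen : ((γ x y).length : ℝ) ≤ N := Nat.cast_le.2 (length_le_maxLength γ x y)
      have hmm : 0 ≤ m x * m y := (mul_pos (hmpos x) (hmpos y)).le
      calc m x * m y * (f x - f y) ^ 2
          ≤ m x * m y * ((γ x y).length * ∑ z, ∑ w, chi (γ x y) z w * (f z - f w) ^ 2) :=
            mul_le_mul_of_nonneg_left (sq_sub_le_length_mul_sum_chi (γ x y) f) hmm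
        _ ≤ m x * m y * (N * ∑ z, ∑ w, chi (γ x y) z w * (f z - f w) ^ 2) := by
            refine mul_le_mul_of_nonneg_left (mul_le_mul_of_nonneg_right hlen ?_) hmm
            exact Finset.sum_nonneg fun z _ => Finset.sum_nonneg fun w _ =>
              mul_nonneg (chi_nonneg _ _ _) (sq_nonneg _)
        _ = N * ∑ z, ∑ w, chi (γ x y) z w * (m x * m y) * (f z - f w) ^ 2 := by
            simp only [Finset.mul_sum]
            exact Finset.sum_congr rfl fun z _ => Finset.sum_congr rfl fun w _ => by ring
        _ ≤ N * ∑ z, ∑ w, chi (γ x y) z w / (π z * Q z w) * (π x * π y / massMin π U) *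
              (e * Z * k z w) * (f z - f w) ^ 2 := by
            refine mul_le_mul_of_nonneg_left (Finset.sum_le_sum fun z _ => Finset.sum_le_sum
              fun w _ => mul_le_mul_of_nonneg_right ?_ (sq_nonneg _)) (Nat.cast_nonneg _)
            exact chi_mul_gibbsWeight_le hQ hU hτ hγ hxy z w
        _ = _ := by
            simp only [Finset.mul_sum]
            exact Finset.sum_congr rfl fun z _ => Finset.sum_congr rfl fun w _ => by ring
  -- Summing over the pairs `(x, y)` first collects the load of each step, which is bounded by its
  -- maximum `T`.
  have hload : ∑ x, ∑ y, ∑ z, ∑ w, chi (γ x y) z w / (π z * Q z w) *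
      (π x * π y / massMin π U) * (k z w * (f z - f w) ^ 2) ≤ T * D := by
    calc _ = ∑ z, ∑ w, stepLoad π U γ (z, w) * (k z w * (f z - f w) ^ 2) := by
          simp only [stepLoad, Finset.sum_mul]
          rw [Finset.sum_congr rfl fun x _ => Finset.sum_comm, Finset.sum_comm]
          refine Finset.sum_congr rfl fun z _ => ?_
          rw [Finset.sum_congr rfl fun x _ => Finset.sum_comm, Finset.sum_comm]
      _ ≤ _ := by
          rw [hD, Finset.mul_sum]
          refine Finset.sum_le_sum fun z _ => ?_
          rw [Finset.mul_sum]
          exact Finset.sum_le_sum fun w _ =>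
            mul_le_mul_of_nonneg_right (stepLoad_le_iSup γ (z, w)) (hkn z w)
  have hmain : 2 * Z * ∑ x, m x * f x ^ 2 ≤ N * (e * Z) * (T * D) := by
    rw [← hvar]
    calc _ ≤ ∑ x, ∑ y, N * (e * Z) * ∑ z, ∑ w, chi (γ x y) z w / (π z * Q z w) *
          (π x * π y / massMin π U) * (k z w * (f z - f w) ^ 2) :=
          Finset.sum_le_sum fun x _ => Finset.sum_le_sum fun y _ => hpair x y
      _ = N * (e * Z) * ∑ x, ∑ y, ∑ z, ∑ w, chi (γ x y) z w / (π z * Q z w) *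
          (π x * π y / massMin π U) * (k z w * (f z - f w) ^ 2) := by
          simp only [Finset.mul_sum]
      _ ≤ _ := mul_le_mul_of_nonneg_left hload (by positivity)
  have hAeq : pathA π U γ = (N * T)⁻¹ := pathA_eq γ
  rw [hAeq] at hA ⊢
  have hNT : 0 < N * T := inv_pos.1 hA
  have hepos : 0 < e := Real.exp_pos _
  have hexp : Real.exp (-c₂ Q U / τ) = e⁻¹ := by rw [he, ← Real.exp_neg, neg_div]
  rw [hexp, ← mul_inv, inv_mul_le_iff₀ (mul_pos hNT hepos)]
  have h2 : Z * (2 * ∑ x, m x * f x ^ 2) ≤ Z * (N * T * e * D) := by linarith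
  have h3 := le_of_mul_le_mul_left h2 hZpos
  linarith

end Path

/-! ### The `χ²`-distance and its rate of change -/

section ChiSquare

variable {S : Type*} [Fintype S]

/-- The `χ²`-distance of `p` from the distribution proportional to the weights `w`. -/
def chiSq (w p : S → ℝ) : ℝ := (∑ x, w x) * ∑ x, p x ^ 2 / w x - 1

variable {w p : S → ℝ}

theorem sum_weight_mul_density_sub (hw : ∀ x, 0 < w x) (hp : ∑ x, p x = 1) :
    ∑ x, w x * (p x / w x - (∑ x, w x)⁻¹) = 0 := by
  have h : ∀ x, w x * (p x / w x - (∑ x, w x)⁻¹) = p x - w x * (∑ x, w x)⁻¹ := fun x => by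
    have := (hw x).ne'
    field_simp
  have hne : Nonempty S := by
    by_contra h
    rw [not_nonempty_iff] at h
    simp at hp
  have hZ : ∑ x, w x ≠ 0 := (Finset.sum_pos (fun x _ => hw x) Finset.univ_nonempty).ne'
  simp_rw [h]
  rw [Finset.sum_sub_distrib, ← Finset.sum_mul, hp, mul_inv_cancel₀ hZ, sub_self]

/-- Expansion of `p²/w = w (p/w)²` about `p/w = a`, used with `h = 1` and `h = U`. -/
theorem sum_mul_sq_div_weight (hw : ∀ x, 0 < w x) (h : S → ℝ) (a : ℝ) :
    ∑ x, h x * (p x ^ 2 / w x) = ∑ x, h x * (w x * (p x / w x - a) ^ 2) +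
      2 * a * ∑ x, h x * (w x * (p x / w x - a)) + a ^ 2 * ∑ x, h x * w x := by
  rw [Finset.mul_sum, Finset.mul_sum, ← Finset.sum_add_distrib, ← Finset.sum_add_distrib]
  refine Finset.sum_congr rfl fun x _ => ?_
  have := (hw x).ne'
  field_simp
  ring

theorem chiSq_eq (hw : ∀ x, 0 < w x) (hZ : 0 < ∑ x, w x) (hp : ∑ x, p x = 1) :
    chiSq w p = (∑ x, w x) * ∑ x, w x * (p x / w x - (∑ x, w x)⁻¹) ^ 2 := by
  have h := sum_mul_sq_div_weight (p := p) hw (fun _ => 1) (∑ x, w x)⁻¹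
  simp only [one_mul, sum_weight_mul_density_sub hw hp] at h
  rw [chiSq, h]
  have := hZ.ne'
  field_simp
  ring

theorem chiSq_nonneg (hw : ∀ x, 0 < w x) (hZ : 0 < ∑ x, w x) (hp : ∑ x, p x = 1) :
    0 ≤ chiSq w p := by
  rw [chiSq_eq hw hZ hp]
  exact mul_nonneg hZ.le (Finset.sum_nonneg fun x _ => mul_nonneg (hw x).le (sq_nonneg _))

/-- Cauchy–Schwarz: expectations of centred densities are controlled by the `χ²`-distance. -/
theorem sum_mul_density_sub_le (hw : ∀ x, 0 < w x) (hZ : 0 < ∑ x, w x) (hp : ∑ x, p x = 1)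
    (h : S → ℝ) {s : ℝ} (hs : ∑ x, h x ^ 2 * w x ≤ s * ∑ x, w x) :
    ∑ x, h x * (w x * (p x / w x - (∑ x, w x)⁻¹)) ≤ √s * √(chiSq w p) := by
  set Z := ∑ x, w x with hZdef
  set g : S → ℝ := fun x => p x / w x - Z⁻¹ with hg
  have hu := chiSq_eq hw hZ hp
  have hG : 0 ≤ ∑ x, w x * g x ^ 2 :=
    Finset.sum_nonneg fun x _ => mul_nonneg (hw x).le (sq_nonneg _)
  have hs0 : 0 ≤ s := by
    have : 0 ≤ s * Z :=
      (Finset.sum_nonneg fun x _ => mul_nonneg (sq_nonneg _) (hw x).le).trans hs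
    exact nonneg_of_mul_nonneg_left this hZ
  rw [← Real.sqrt_mul hs0]
  refine Real.le_sqrt_of_sq_le ?_
  have hcs := Finset.sum_mul_sq_le_sq_mul_sq Finset.univ (fun x => h x * √(w x))
    (fun x => √(w x) * g x)
  have hsq : ∀ x, √(w x) * √(w x) = w x := fun x => Real.mul_self_sqrt (hw x).le
  have h1 : ∑ x, h x * √(w x) * (√(w x) * g x) = ∑ x, h x * (w x * g x) :=
    Finset.sum_congr rfl fun x _ => by rw [← hsq x]; ring_nf; simp [Real.sqrt_sq]
  have h2 : ∑ x, (h x * √(w x)) ^ 2 = ∑ x, h x ^ 2 * w x :=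
    Finset.sum_congr rfl fun x _ => by rw [mul_pow, Real.sq_sqrt (hw x).le]
  have h3 : ∑ x, (√(w x) * g x) ^ 2 = ∑ x, w x * g x ^ 2 :=
    Finset.sum_congr rfl fun x _ => by rw [mul_pow, Real.sq_sqrt (hw x).le]
  rw [h1, h2, h3] at hcs
  rw [hu]
  calc _ ≤ (∑ x, h x ^ 2 * w x) * ∑ x, w x * g x ^ 2 := hcs
    _ ≤ s * Z * ∑ x, w x * g x ^ 2 := mul_le_mul_of_nonneg_right hs hG
    _ = _ := by ring

/-- The rate of change of the `χ²`-distance when `p` moves with a reversible generator `L` with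
spectral gap `lam`, and the weights `w` change at rate `-d * U * w`. -/
theorem chiSq_rate_le (hw : ∀ x, 0 < w x) (hZ : 0 < ∑ x, w x) (hp : ∑ x, p x = 1)
    {U : S → ℝ} (hU0 : ∀ x, 0 ≤ U x) {R : ℝ} (hUR : ∀ x, U x ≤ R) {d : ℝ} (hd : 0 ≤ d)
    {L : Matrix S S ℝ} (hL : ∀ x y, w x * L x y = w y * L y x) (hrow : ∀ x, ∑ y, L x y = 0)
    {lam : ℝ} (hgap : ∀ f : S → ℝ, ∑ x, w x * f x = 0 →
      lam * ∑ x, w x * f x ^ 2 ≤ ∑ x, w x * f x * ∑ y, (-L) x y * f y)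
    {s : ℝ} (hs : ∑ x, U x ^ 2 * w x ≤ s * ∑ x, w x) :
    (∑ x, -(d * U x) * w x) * ∑ x, p x ^ 2 / w x +
      (∑ x, w x) * ∑ x, (2 * p x * (∑ z, p z * L z x) / w x + d * U x * (p x ^ 2 / w x)) ≤
      -2 * lam * chiSq w p + d * (R * chiSq w p + 2 * (√s * √(chiSq w p))) := by
  set Z := ∑ x, w x with hZdef
  set g : S → ℝ := fun x => p x / w x - Z⁻¹ with hg
  have hu : chiSq w p = Z * ∑ x, w x * g x ^ 2 := chiSq_eq hw hZ hp
  have hg0 : ∑ x, w x * g x = 0 := sum_weight_mul_density_sub hw hp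
  -- By reversibility `pL = w · L(p/w)`, and the Dirichlet form does not see the constant subtracted
  -- from `p/w`.
  have hdir : ∑ x, 2 * p x * (∑ z, p z * L z x) / w x =
      -2 * ∑ x, w x * g x * ∑ y, (-L) x y * g y := by
    have h1 : ∑ x, w x * g x * ∑ y, (-L) x y * g y =
        ∑ x, w x * (p x / w x) * ∑ y, (-L) x y * (p y / w y) := by
      rw [dirichlet_form_eq hL hrow, dirichlet_form_eq hL hrow (fun x => p x / w x)]
      congr 1
      refine Finset.sum_congr rfl fun x _ => Finset.sum_congr rfl fun y _ => ?_
      simp only [hg]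
      ring
    rw [h1, Finset.mul_sum]
    refine Finset.sum_congr rfl fun x _ => ?_
    have hx := (hw x).ne'
    have h2 : ∑ z, p z * L z x = w x * ∑ y, L x y * (p y / w y) := by
      rw [Finset.mul_sum]
      refine Finset.sum_congr rfl fun z _ => ?_
      have hz := (hw z).ne'
      rw [← mul_assoc, hL x z]
      field_simp
    have h3 : ∑ y, (-L) x y * (p y / w y) = -∑ y, L x y * (p y / w y) := by
      rw [← Finset.sum_neg_distrib]
      exact Finset.sum_congr rfl fun y _ => by rw [Matrix.neg_apply, neg_mul]
    rw [h2, h3]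
    field_simp
  have hpot := sum_mul_sq_div_weight (p := p) hw U Z⁻¹
  have hone := sum_mul_sq_div_weight (p := p) hw (fun _ => 1) Z⁻¹
  simp only [one_mul] at hone
  have hlin := sum_mul_density_sub_le hw hZ hp U hs
  have hUg : ∑ x, U x * (w x * g x ^ 2) ≤ R * ∑ x, w x * g x ^ 2 := by
    rw [Finset.mul_sum]
    exact Finset.sum_le_sum fun x _ =>
      mul_le_mul_of_nonneg_right (hUR x) (mul_nonneg (hw x).le (sq_nonneg _))
  have hUw : 0 ≤ ∑ x, U x * w x := Finset.sum_nonneg fun x _ => mul_nonneg (hU0 x) (hw x).le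
  have hG : 0 ≤ ∑ x, w x * g x ^ 2 :=
    Finset.sum_nonneg fun x _ => mul_nonneg (hw x).le (sq_nonneg _)
  have hgap' := hgap g hg0
  change _ = ∑ x, U x * (w x * g x ^ 2) + 2 * Z⁻¹ * ∑ x, U x * (w x * g x) + _ at hpot
  change _ = ∑ x, w x * g x ^ 2 + 2 * Z⁻¹ * ∑ x, w x * g x + Z⁻¹ ^ 2 * Z at hone
  change ∑ x, U x * (w x * g x) ≤ _ at hlin
  have e1 : ∑ x, -(d * U x) * w x = -d * ∑ x, U x * w x := by
    rw [Finset.mul_sum]; exact Finset.sum_congr rfl fun x _ => by ring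
  have e2 : ∑ x, (2 * p x * (∑ z, p z * L z x) / w x + d * U x * (p x ^ 2 / w x)) =
      -2 * ∑ x, w x * g x * ∑ y, (-L) x y * g y + d * ∑ x, U x * (p x ^ 2 / w x) := by
    rw [Finset.sum_add_distrib, hdir, Finset.mul_sum (a := d)]
    congr 1
    exact Finset.sum_congr rfl fun x _ => by ring
  rw [e1, e2, hpot, hone, hg0]
  set a := ∑ x, U x * w x
  set G := ∑ x, w x * g x ^ 2
  set V := ∑ x, U x * (w x * g x ^ 2)
  set D := ∑ x, w x * g x * ∑ y, (-L) x y * g y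
  set l := ∑ x, U x * (w x * g x)
  set r := √s * √(chiSq w p)
  rw [hu]
  have hZne := hZ.ne'
  have e3 : -d * a * (G + 2 * Z⁻¹ * 0 + Z⁻¹ ^ 2 * Z) +
      Z * (-2 * D + d * (V + 2 * Z⁻¹ * l + Z⁻¹ ^ 2 * a)) =
      -2 * (Z * D) + d * (Z * V + 2 * l - a * G) := by
    field_simp
    ring
  rw [e3]
  have i1 : Z * (lam * G) ≤ Z * D := mul_le_mul_of_nonneg_left hgap' hZ.le
  -- The term `-a * G`, coming from the decrease of `Z`, has a favourable sign and is dropped.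
  have i2 : Z * V + 2 * l - a * G ≤ R * (Z * G) + 2 * r := by
    have := mul_le_mul_of_nonneg_left hUg hZ.le
    have := mul_nonneg hUw hG
    linarith
  have i3 := mul_le_mul_of_nonneg_left i2 hd
  linarith

end ChiSquare

/-- A comparison principle for `v' ≤ 2 G' √v`. -/
theorem sqrt_le_of_deriv_le {v v' G G' : ℝ → ℝ} (hv : ContinuousOn v (Set.Ici 0))
    (hG : ContinuousOn G (Set.Ici 0)) (hv' : ∀ t, 0 < t → HasDerivAt v (v' t) t)
    (hG' : ∀ t, 0 < t → HasDerivAt G (G' t) t) (hv0 : ∀ t, 0 ≤ t → 0 ≤ v t)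
    (hG0 : ∀ t, 0 < t → 0 ≤ G' t) (hle : ∀ t, 0 < t → v' t ≤ 2 * G' t * √(v t))
    {t : ℝ} (ht : 0 ≤ t) : √(v t) ≤ √(v 0) + (G t - G 0) := by
  refine le_of_forall_pos_le_add fun δ hδ => ?_
  have hpos : ∀ s, 0 ≤ s → 0 < v s + δ ^ 2 := fun s hs => by
    have := hv0 s hs
    positivity
  -- The shift by `δ²` keeps the root differentiable where `v` vanishes; it costs only `δ` at time
  -- `0`.
  have hanti : AntitoneOn (fun s => √(v s + δ ^ 2) - G s) (Set.Ici 0) := by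
    have hderiv : ∀ s ∈ interior (Set.Ici (0 : ℝ)),
        HasDerivAt (fun s => √(v s + δ ^ 2) - G s) (v' s / (2 * √(v s + δ ^ 2)) - G' s) s := by
      intro s hs
      rw [interior_Ici] at hs
      exact (((hv' s hs).add_const _).sqrt (hpos s (le_of_lt hs)).ne').sub (hG' s hs)
    refine antitoneOn_of_deriv_nonpos (convex_Ici 0) ?_
      (fun s hs => (hderiv s hs).differentiableAt.differentiableWithinAt) fun s hs => ?_
    · exact ((hv.add continuousOn_const).sqrt).sub hG
    · rw [(hderiv s hs).deriv]
      rw [interior_Ici] at hs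
      have h1 : 0 < √(v s + δ ^ 2) := Real.sqrt_pos.2 (hpos s (le_of_lt hs))
      have h2 : √(v s) ≤ √(v s + δ ^ 2) := Real.sqrt_le_sqrt (by nlinarith)
      rw [sub_nonpos, div_le_iff₀ (by positivity)]
      have h3 := mul_le_mul_of_nonneg_left h2 (hG0 s hs)
      have h4 := hle s hs
      linarith
  have h1 : √(v t + δ ^ 2) - G t ≤ √(v 0 + δ ^ 2) - G 0 := hanti Set.self_mem_Ici ht ht
  have h2 : √(v t) ≤ √(v t + δ ^ 2) := Real.sqrt_le_sqrt (by nlinarith)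
  have h3 : √(v 0 + δ ^ 2) ≤ √(v 0) + δ := by
    refine Real.sqrt_le_iff.2 ⟨by positivity, ?_⟩
    have := Real.sq_sqrt (hv0 0 le_rfl)
    nlinarith [Real.sqrt_nonneg (v 0)]
  linarith

/-! ### The cooling schedule and Gibbs estimates -/

section Cooling

variable {S : Type*} [Fintype S] {Q : Matrix S S ℝ} {π U : S → ℝ}

/-- The inverse temperature `log (ρ t + 1) / c` of a logarithmic cooling schedule. -/
def invTemp (c ρ t : ℝ) : ℝ := Real.log (ρ * t + 1) / c

theorem invTemp_zero (c ρ : ℝ) : invTemp c ρ 0 = 0 := by simp [invTemp]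

theorem invTemp_nonneg {c ρ t : ℝ} (hc : 0 < c) (hρ : 0 ≤ ρ) (ht : 0 ≤ t) : 0 ≤ invTemp c ρ t :=
  div_nonneg (Real.log_nonneg (by nlinarith [mul_nonneg hρ ht])) hc.le

theorem hasDerivAt_invTemp {c ρ t : ℝ} (hρt : 0 < ρ * t + 1) :
    HasDerivAt (invTemp c ρ) (ρ / (c * (ρ * t + 1))) t := by
  have h := (((hasDerivAt_id t).const_mul ρ).add_const 1).log hρt.ne'
  refine HasDerivAt.congr_deriv (f := invTemp c ρ) (h.div_const c) ?_
  change ρ * 1 / (ρ * t + 1) / c = _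
  rw [mul_one, div_div, mul_comm]

theorem rpow_neg_div_eq_exp {c ρ t : ℝ} (hρt : 0 < ρ * t + 1) (r : ℝ) :
    (ρ * t + 1) ^ (-(r / c)) = Real.exp (-(invTemp c ρ t * r)) := by
  rw [Real.rpow_def_of_pos hρt, invTemp]
  congr 1
  ring

/-- At `t = 0` the schedule takes the value `c₂ / 0 = 0`, and both sides are `π x`, as infinite
temperature requires. -/
theorem gibbsWeight_cooling (A t : ℝ) (x : S) :
    gibbsWeight π U (cooling Q U A t) x =
      π x * Real.exp (-(invTemp (c₂ Q U) (rho Q U A) t * U x)) := by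
  rw [gibbsWeight, cooling, div_div_eq_mul_div, invTemp]
  congr 2
  ring

theorem rho_pos (hQ : IsProposal Q π) (hU : ⨅ x, U x = 0) (hc : 0 < c₂ Q U) {A : ℝ}
    (hA : 0 < A) : 0 < rho Q U A :=
  div_pos (by positivity) (mul_pos three_pos (constR_pos hQ hU hc))

theorem constK_nonneg (hQ : IsProposal Q π) : 0 ≤ constK π U := by
  classical
  refine sub_nonneg.2 ((one_le_inv₀ (massMin_pos hQ)).2 ?_)
  rw [← hQ.prob_sum]
  unfold massMin
  exact Finset.sum_le_sum_of_subset_of_nonneg (Finset.filter_subset _ _)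
    fun x _ _ => (hQ.prob_pos x).le

open Classical in
/-- The Gibbs distribution puts mass at most `K e^{-β B}` on the complement of `U_min`. -/
theorem sum_notMem_Umin_le (hQ : IsProposal Q π) (hU : ⨅ x, U x = 0) {b : ℝ} (hb : 0 ≤ b) :
    ∑ x ∈ Finset.univ.filter (fun x => x ∉ Umin U), π x * Real.exp (-(b * U x)) ≤
      constK π U * Real.exp (-(b * constB U)) * ∑ x, π x * Real.exp (-(b * U x)) := by
  have hM := massMin_pos (U := U) hQ
  have hsplit : massMin π U + ∑ x ∈ Finset.univ.filter (fun x => x ∉ Umin U), π x = 1 := by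
    rw [← hQ.prob_sum, massMin]
    exact Finset.sum_filter_add_sum_filter_not _ _ _
  have hZ : massMin π U ≤ ∑ x, π x * Real.exp (-(b * U x)) := by
    have h := massMin_le_sum_gibbsWeight (τ := b⁻¹) hQ hU
    refine h.trans_eq (Finset.sum_congr rfl fun x _ => ?_)
    rw [gibbsWeight, div_inv_eq_mul]
    congr 2
    ring
  calc _ ≤ ∑ x ∈ Finset.univ.filter (fun x => x ∉ Umin U), π x * Real.exp (-(b * constB U)) := by
        refine Finset.sum_le_sum fun x hx => mul_le_mul_of_nonneg_left ?_ (hQ.prob_nonneg x)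
        have := mul_le_mul_of_nonneg_left
          (constB_le hU (Finset.mem_filter.1 hx).2) hb
        exact Real.exp_le_exp.2 (by linarith)
    -- The complement of `U_min` has `π`-mass `1 - π(U_min) = K π(U_min)`.
    _ = constK π U * Real.exp (-(b * constB U)) * massMin π U := by
        rw [← Finset.sum_mul, eq_sub_of_add_eq' hsplit, constK]
        field_simp
    _ ≤ _ := mul_le_mul_of_nonneg_left hZ (mul_nonneg (constK_nonneg hQ) (Real.exp_pos _).le)

/-- Only states off `U_min` contribute, so the second moment of `U` inherits the decay `e^{-βB}`. It
controls the cost of moving the target. -/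
theorem sum_sq_mul_weight_le (hQ : IsProposal Q π) (hU : ⨅ x, U x = 0) {b : ℝ} (hb : 0 ≤ b) :
    ∑ x, U x ^ 2 * (π x * Real.exp (-(b * U x))) ≤
      constR U ^ 2 * (constK π U * Real.exp (-(b * constB U))) *
        ∑ x, π x * Real.exp (-(b * U x)) := by
  classical
  calc _ = ∑ x ∈ Finset.univ.filter (fun x => x ∉ Umin U),
        U x ^ 2 * (π x * Real.exp (-(b * U x))) := by
        rw [Finset.sum_filter]
        refine Finset.sum_congr rfl fun x _ => ?_
        by_cases hx : x ∈ Umin U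
        · simp [(mem_Umin_iff hU x).1 hx]
        · rw [if_pos hx]
    _ ≤ ∑ x ∈ Finset.univ.filter (fun x => x ∉ Umin U),
        constR U ^ 2 * (π x * Real.exp (-(b * U x))) :=
        Finset.sum_le_sum fun x _ => mul_le_mul_of_nonneg_right
          (pow_le_pow_left₀ (nonneg_of_iInf_eq_zero hU x) (le_constR hU x) 2)
          (mul_nonneg (hQ.prob_nonneg x) (Real.exp_pos _).le)
    _ ≤ _ := by
        rw [← Finset.mul_sum, mul_assoc]
        exact mul_le_mul_of_nonneg_left (sum_notMem_Umin_le hQ hU hb) (sq_nonneg _)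

end Cooling

/-! ### Transition probabilities and marginals of the chain -/

section Transition

variable {S : Type*} [Fintype S] [DecidableEq S]

theorem IsTransitionSemigroup.row_sum {M : ℝ → Matrix S S ℝ} {P : ℝ → ℝ → Matrix S S ℝ}
    (hP : IsTransitionSemigroup M P) (hM : ∀ t x, ∑ y, M t x y = 0) {t : ℝ} (ht : 0 ≤ t)
    (x : S) : ∑ y, P 0 t x y = 1 := by
  obtain ⟨h0, hd⟩ := hP 0 le_rfl
  have hderiv : ∀ s, 0 ≤ s → HasDerivWithinAt (fun u => ∑ y, P 0 u x y) 0 (Set.Ici 0) s := by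
    intro s hs
    have h := HasDerivWithinAt.fun_sum fun y (_ : y ∈ Finset.univ) => hd s hs x y
    refine h.congr_deriv ?_
    simp only [Matrix.mul_apply]
    rw [Finset.sum_comm]
    refine Finset.sum_eq_zero fun z _ => ?_
    rw [← Finset.mul_sum, hM, mul_zero]
  have h := constant_of_has_deriv_right_zero (a := 0) (b := t)
    (fun s hs => ((hderiv s hs.1).continuousWithinAt).mono Set.Icc_subset_Ici_self)
    (fun s hs => (hderiv s hs.1).mono (Set.Ici_subset_Ici.2 hs.1)) t ⟨ht, le_rfl⟩
  rw [h, h0]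
  simp [Matrix.one_apply]

/-- A union bound over the value at time `0`, where only `x` has positive probability; an upper
bound on the marginal is all that is needed. -/
theorem IsMarkovChain.exists_transition {Ω : Type*} [MeasurableSpace Ω] {ℙ : Measure Ω}
    [IsProbabilityMeasure ℙ] {M : ℝ → Matrix S S ℝ} {x : S} {X : ℝ → Ω → S}
    (hX : IsMarkovChain ℙ M x X) : ∃ P : ℝ → ℝ → Matrix S S ℝ, IsTransitionSemigroup M P ∧
      ∀ t, 0 ≤ t → ∀ y, ℙ.real {ω | X t ω = y} ≤ P 0 t x y := by
  obtain ⟨P, hP, hlaw⟩ := hX.law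
  refine ⟨P, hP, fun t ht y => ?_⟩
  have h2 : ∀ z, ℙ.real {ω | X 0 ω = z ∧ X t ω = y} = (if z = x then 1 else 0) * P 0 t z y := by
    intro z
    have h := hlaw 1 ![0, t] ![z, y] rfl (by
      intro i j hij
      fin_cases i <;> fin_cases j <;> simp_all)
    refine (Eq.trans ?_ h).trans ?_
    · simp [Fin.forall_fin_two]
    · by_cases hz : z = x <;> simp [hz]
  calc ℙ.real {ω | X t ω = y}
      = ℙ.real (⋃ z ∈ (Finset.univ : Finset S), {ω | X 0 ω = z ∧ X t ω = y}) := by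
        congr 1
        ext ω
        simp
    _ ≤ ∑ z, ℙ.real {ω | X 0 ω = z ∧ X t ω = y} := measureReal_biUnion_finset_le _ _
    _ = P 0 t x y := by simp [h2]

end Transition

/-! ### Convergence of the annealed chain -/

section Annealed

variable {S : Type*} [Fintype S] [DecidableEq S] {Q : Matrix S S ℝ} {π U : S → ℝ} {A : ℝ}

theorem two_le_card_of_c₂_pos (hc : 0 < c₂ Q U) : 2 ≤ Fintype.card S := by
  obtain ⟨x, y, hne, -⟩ := exists_lt_H₂_of_c₂_pos hc
  exact Fintype.one_lt_card_iff.2 ⟨x, y, hne⟩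

theorem cooling_nonneg (hQ : IsProposal Q π) (hU : ⨅ x, U x = 0) (hc : 0 < c₂ Q U)
    (hA : 0 < A) {t : ℝ} (ht : 0 ≤ t) : 0 ≤ cooling Q U A t :=
  div_nonneg hc.le (Real.log_nonneg (by nlinarith [mul_nonneg (rho_pos hQ hU hc hA).le ht]))

/-- The Poincaré inequality for the annealed generator at time `t`. -/
theorem poincare_cooling (hQ : IsProposal Q π) (hU : ⨅ x, U x = 0) (hc : 0 < c₂ Q U)
    (hA : IsGapConstant Q U A) {t : ℝ} (ht : 0 < t) (f : S → ℝ)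
    (hf : ∑ x, gibbsWeight π U (cooling Q U A t) x * f x = 0) :
    A / (rho Q U A * t + 1) * ∑ x, gibbsWeight π U (cooling Q U A t) x * f x ^ 2 ≤
      ∑ x, gibbsWeight π U (cooling Q U A t) x * f x *
        ∑ y, (-gen₂ Q U (cooling Q U A t)) x y * f y := by
  have hρt := mul_pos (rho_pos hQ hU hc hA.1) ht
  have hlog : 0 < Real.log (rho Q U A * t + 1) := Real.log_pos (by linarith)
  have hτ : 0 < cooling Q U A t := div_pos hc hlog
  have hgap := hA.2 _ hτ
  have hexp : A * Real.exp (-c₂ Q U / cooling Q U A t) = A / (rho Q U A * t + 1) := by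
    rw [cooling, div_div_eq_mul_div, neg_mul, neg_div, mul_div_cancel_left₀ _ hc.ne',
      Real.exp_neg, Real.exp_log (by linarith), div_eq_mul_inv]
  rw [hexp] at hgap
  refine poincare_of_le_lambda₂ (gibbsWeight_pos hQ) (fun x y => ?_) (fun x => ?_)
    (two_le_card_of_c₂_pos hc) (div_pos hA.1 (by linarith)) hgap f hf
  · rw [Matrix.neg_apply, Matrix.neg_apply, mul_neg, mul_neg, gibbsWeight_gen₂_symm hQ hτ.le]
  · simp only [Matrix.neg_apply, Finset.sum_neg_distrib, gen₂_row_sum, neg_zero]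

/-- The decay of the `χ²`-distance between the law of the annealed chain and the Gibbs
distribution at the current temperature. -/
theorem sqrt_chiSq_le (hQ : IsProposal Q π) (hU : ⨅ x, U x = 0) (hc : 0 < c₂ Q U)
    (hA : IsGapConstant Q U A) {P : ℝ → ℝ → Matrix S S ℝ}
    (hP : IsTransitionSemigroup (fun t => gen₂ Q U (cooling Q U A t)) P) (x : S) {t : ℝ}
    (ht : 0 ≤ t) :
    √(chiSq (gibbsWeight π U (cooling Q U A t)) (P 0 t x)) ≤
      √((π x)⁻¹ - 1) * Real.exp (-(invTemp (c₂ Q U) (rho Q U A) t * constR U)) +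
        2 * √(constK π U) *
          Real.exp (-(invTemp (c₂ Q U) (rho Q U A) t * (constB U / 2))) := by
  set c := c₂ Q U with hcdef
  set ρ := rho Q U A with hρdef
  set R := constR U with hRdef
  set B := constB U with hBdef
  set K := constK π U with hKdef
  have hρ : 0 < ρ := rho_pos hQ hU hc hA.1
  have hR : 0 < R := constR_pos hQ hU hc
  have hBR : B ≤ R := constB_le_constR hU hR
  have hK : 0 ≤ K := constK_nonneg hQ
  set b : ℝ → ℝ := invTemp c ρ with hb
  set w : ℝ → S → ℝ := fun s => gibbsWeight π U (cooling Q U A s) with hw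
  have hwexp : ∀ s y, w s y = π y * Real.exp (-(b s * U y)) := fun s y => gibbsWeight_cooling A s y
  have hwpos : ∀ s y, 0 < w s y := fun s y => gibbsWeight_pos hQ y
  have hZpos : ∀ s, 0 < ∑ y, w s y := fun s =>
    (massMin_pos hQ).trans_le (massMin_le_sum_gibbsWeight hQ hU)
  have hpsum : ∀ s, 0 ≤ s → ∑ y, P 0 s x y = 1 := fun s hs =>
    hP.row_sum (fun _ _ => gen₂_row_sum _) hs x
  obtain ⟨hP0, hPd⟩ := hP 0 le_rfl
  set u : ℝ → ℝ := fun s => chiSq (w s) (P 0 s x) with hu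
  have hu0 : ∀ s, 0 ≤ s → 0 ≤ u s := fun s hs =>
    chiSq_nonneg (hwpos s) (hZpos s) (hpsum s hs)
  have hρs : ∀ s, 0 ≤ s → 0 < ρ * s + 1 := fun s hs => by positivity
  set d : ℝ → ℝ := fun s => ρ / (c * (ρ * s + 1)) with hd
  have hbd : ∀ s, 0 ≤ s → HasDerivAt b (d s) s := fun s hs => hasDerivAt_invTemp (hρs s hs)
  have hwd : ∀ s, 0 ≤ s → ∀ y, HasDerivAt (fun s => w s y) (-(d s * U y) * w s y) s := by
    intro s hs y
    have h := (((hbd s hs).mul_const (U y)).neg.exp).const_mul (π y)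
    simp only [hwexp]
    exact h.congr_deriv (by simp only [Pi.neg_apply]; ring)
  have hud : ∀ s, 0 ≤ s → HasDerivWithinAt u
      ((∑ y, -(d s * U y) * w s y) * ∑ y, P 0 s x y ^ 2 / w s y +
        (∑ y, w s y) * ∑ y, (2 * P 0 s x y *
          (∑ z, P 0 s x z * gen₂ Q U (cooling Q U A s) z y) / w s y +
            d s * U y * (P 0 s x y ^ 2 / w s y))) (Set.Ici 0) s := by
    intro s hs
    have h1 := HasDerivWithinAt.fun_sum fun y (_ : y ∈ Finset.univ) =>
      (hwd s hs y).hasDerivWithinAt (s := Set.Ici 0)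
    have h2 := HasDerivWithinAt.fun_sum fun y (_ : y ∈ Finset.univ) =>
      ((hPd s hs x y).fun_pow 2).fun_div ((hwd s hs y).hasDerivWithinAt (s := Set.Ici 0))
        (hwpos s y).ne'
    refine ((h1.mul h2).sub_const 1).congr_deriv ?_
    congr 2
    refine Finset.sum_congr rfl fun y _ => ?_
    have := (hwpos s y).ne'
    rw [Matrix.mul_apply]
    field_simp
    ring
  have hDu : ∀ s, 0 < s → ∃ u', HasDerivAt u u' s ∧
      u' ≤ d s * R * (-2 * u s + 2 * (√K * Real.exp (-(b s * (B / 2)))) * √(u s)) := by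
    intro s hs
    refine ⟨_, (hud s hs.le).hasDerivAt (Ici_mem_nhds hs), ?_⟩
    have hbs : 0 ≤ b s := invTemp_nonneg hc hρ.le hs.le
    have hds : 0 ≤ d s := by have := hρs s hs.le; simp only [hd]; positivity
    have hsecond : ∑ y, U y ^ 2 * w s y ≤
        R ^ 2 * (K * Real.exp (-(b s * B))) * ∑ y, w s y := by
      simp only [hwexp]
      exact sum_sq_mul_weight_le hQ hU hbs
    have hrate := chiSq_rate_le (hwpos s) (hZpos s) (hpsum s hs.le)
      (nonneg_of_iInf_eq_zero hU) (le_constR hU) hds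
      (gibbsWeight_gen₂_symm hQ (cooling_nonneg hQ hU hc hA.1 hs.le)) gen₂_row_sum
      (poincare_cooling hQ hU hc hA hs) hsecond
    refine hrate.trans_eq ?_
    have hsqrt : √(R ^ 2 * (K * Real.exp (-(b s * B)))) =
        R * (√K * Real.exp (-(b s * (B / 2)))) := by
      rw [Real.sqrt_mul (sq_nonneg R), Real.sqrt_sq hR.le, Real.sqrt_mul hK, Real.sqrt_eq_rpow
        (Real.exp _), ← Real.exp_mul]
      congr 3
      ring
    -- This identity dictates `ρ`: twice the gap is `3 β' R`, of which one `β' R` pays for the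
    -- cooling and `2 β' R` remain.
    have hrel : A / (ρ * s + 1) = 3 / 2 * (d s * R) := by
      have h1 := (hρs s hs.le).ne'
      have h2 : ρ * (3 * R) = 2 * c * A := by
        rw [hρdef, rho, ← hcdef, ← hRdef]
        field_simp
      simp only [hd]
      have hc' := hc.ne'
      field_simp
      linarith
    change -2 * (A / (ρ * s + 1)) * u s + d s * (R * u s + 2 * (_ * √(u s))) = _
    rw [hsqrt, hrel]
    ring
  choose! u' hu'd hu'le using hDu
  -- With `v = e^{2Rβ} u` the differential inequality becomes `v' ≤ 2 G' √v`, where `G' = R √K β'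
  -- e^{βq}`.
  set q : ℝ := R - B / 2 with hq
  have hqpos : 0 < q := by linarith
  have hbcont : ContinuousOn b (Set.Ici 0) := fun s hs => (hbd s hs).continuousAt.continuousWithinAt
  have hcomp := sqrt_le_of_deriv_le
    (v := fun s => Real.exp (b s * (2 * R)) * u s)
    (v' := fun s => Real.exp (b s * (2 * R)) * (d s * (2 * R)) * u s +
      Real.exp (b s * (2 * R)) * u' s)
    (G := fun s => R * √K / q * Real.exp (b s * q))
    (G' := fun s => R * √K / q * (Real.exp (b s * q) * (d s * q)))
    ?_ ?_ ?_ ?_ ?_ ?_ ?_ ht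
  · have hb0 : b 0 = 0 := invTemp_zero c ρ
    have hw0 : ∀ y, w 0 y = π y := fun y => by rw [hwexp, hb0]; simp
    have hu00 : u 0 = (π x)⁻¹ - 1 := by
      simp only [hu, chiSq, hw0, hQ.prob_sum, hP0, one_mul]
      rw [Finset.sum_eq_single x (fun y _ hy => by simp [Matrix.one_apply_ne hy.symm]) (by simp)]
      simp
    rw [hb0, hu00, zero_mul, Real.exp_zero, one_mul, zero_mul, Real.exp_zero, mul_one,
      Real.sqrt_mul (Real.exp_pos _).le] at hcomp
    have hhalf : √(Real.exp (b t * (2 * R))) = Real.exp (b t * R) := by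
      rw [Real.sqrt_eq_rpow, ← Real.exp_mul]
      congr 1
      ring
    rw [hhalf] at hcomp
    -- Since `B ≤ R`, `q ≥ R / 2`.
    have hRq : R * √K / q ≤ 2 * √K := by
      rw [div_le_iff₀ hqpos]
      nlinarith [Real.sqrt_nonneg K]
    have hRq0 : 0 ≤ R * √K / q := by positivity
    have h1 : Real.exp (b t * R) * √(u t) ≤
        √((π x)⁻¹ - 1) + 2 * √K * Real.exp (b t * q) := by
      have := mul_le_mul_of_nonneg_right hRq (Real.exp_pos (b t * q)).le
      linarith
    have h2 := mul_le_mul_of_nonneg_left h1 (Real.exp_pos (-(b t * R))).le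
    rw [← mul_assoc, ← Real.exp_add, neg_add_cancel, Real.exp_zero, one_mul] at h2
    refine h2.trans_eq ?_
    have h3 : Real.exp (-(b t * (B / 2))) = Real.exp (-(b t * R)) * Real.exp (b t * q) := by
      rw [← Real.exp_add, hq]
      congr 1
      ring
    rw [h3]
    ring
  · exact ((hbcont.mul continuousOn_const).rexp).mul fun s hs => (hud s hs).continuousWithinAt
  · exact continuousOn_const.mul (hbcont.mul continuousOn_const).rexp
  · exact fun s hs => (((hbd s hs.le).mul_const _).exp).mul (hu'd s hs)
  · exact fun s hs => (((hbd s hs.le).mul_const _).exp).const_mul _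
  · exact fun s hs => mul_nonneg (Real.exp_pos _).le (hu0 s hs)
  · intro s hs
    have := hρs s hs.le
    simp only [hd]
    positivity
  · intro s hs
    have hE : 0 < Real.exp (b s * (2 * R)) := Real.exp_pos _
    have hhalf : √(Real.exp (b s * (2 * R))) = Real.exp (b s * R) := by
      rw [Real.sqrt_eq_rpow, ← Real.exp_mul]
      congr 1
      ring
    have h1 := mul_le_mul_of_nonneg_left (hu'le s hs) hE.le
    have h2 : Real.exp (b s * q) * Real.exp (b s * R) =
        Real.exp (b s * (2 * R)) * Real.exp (-(b s * (B / 2))) := by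
      rw [← Real.exp_add, ← Real.exp_add, hq]
      congr 1
      ring
    rw [Real.sqrt_mul hE.le, hhalf]
    have h3 : 2 * (R * √K / q * (Real.exp (b s * q) * (d s * q))) *
        (Real.exp (b s * R) * √(u s)) =
        2 * R * √K * d s * (Real.exp (b s * (2 * R)) * Real.exp (-(b s * (B / 2)))) * √(u s) := by
      rw [← h2]
      field_simp
    rw [h3]
    linarith

/-- The probability is the Gibbs mass off `U_min` plus a fluctuation bounded by `√(K e^{-βB}) √u`.
The mass contributes `K e^{-βB}` and the fluctuation `2K e^{-βB}`, whence the factor `3`. -/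
theorem annealing_bound (hQ : IsProposal Q π) (hU : ⨅ x, U x = 0) (hc : 0 < c₂ Q U)
    (hA : IsGapConstant Q U A) {Ω : Type*} [MeasurableSpace Ω] (ℙ : Measure Ω)
    [IsProbabilityMeasure ℙ] (x : S) (X : ℝ → Ω → S)
    (hX : IsMarkovChain ℙ (fun t => gen₂ Q U (cooling Q U A t)) x X) {t : ℝ} (ht : 0 ≤ t) :
    ℙ.real {ω | X t ω ∉ Umin U} ≤
      3 * constK π U * (rho Q U A * t + 1) ^ (-(constB U / c₂ Q U)) +
        ((π x)⁻¹ - 1) ^ (1 / 2 : ℝ) * constK π U ^ (1 / 2 : ℝ) *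
          (rho Q U A * t + 1) ^ (-((constR U + constB U / 2) / c₂ Q U)) := by
  classical
  obtain ⟨P, hP, hXP⟩ := hX.exists_transition
  have hρ : 0 < rho Q U A := rho_pos hQ hU hc hA.1
  have hρt : 0 < rho Q U A * t + 1 := by positivity
  have hK : 0 ≤ constK π U := constK_nonneg hQ
  have hu := sqrt_chiSq_le hQ hU hc hA hP x ht
  rw [rpow_neg_div_eq_exp hρt, rpow_neg_div_eq_exp hρt, ← Real.sqrt_eq_rpow, ← Real.sqrt_eq_rpow]
  have hb : 0 ≤ invTemp (c₂ Q U) (rho Q U A) t := invTemp_nonneg hc hρ.le ht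
  set b := invTemp (c₂ Q U) (rho Q U A) t with hbdef
  set w := gibbsWeight π U (cooling Q U A t) with hw
  have hwexp : ∀ y, w y = π y * Real.exp (-(b * U y)) := gibbsWeight_cooling A t
  have hwpos : ∀ y, 0 < w y := gibbsWeight_pos hQ
  have hZ : 0 < ∑ y, w y := (massMin_pos hQ).trans_le (massMin_le_sum_gibbsWeight hQ hU)
  have hpsum : ∑ y, P 0 t x y = 1 := hP.row_sum (fun _ _ => gen₂_row_sum _) ht x
  set B := constB U
  set R := constR U
  set K := constK π U
  set I : S → ℝ := fun y => if y ∉ Umin U then 1 else 0 with hI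
  have hW : ∑ y, I y * w y ≤ K * Real.exp (-(b * B)) * ∑ y, w y := by
    have h := sum_notMem_Umin_le hQ hU hb
    simp only [hwexp]
    rw [Finset.sum_filter] at h
    refine le_of_eq_of_le (Finset.sum_congr rfl fun y _ => ?_) h
    simp only [hI]
    split_ifs <;> simp
  have hW2 : ∑ y, I y ^ 2 * w y ≤ K * Real.exp (-(b * B)) * ∑ y, w y := by
    refine le_of_eq_of_le (Finset.sum_congr rfl fun y _ => ?_) hW
    simp only [hI]
    split_ifs <;> simp
  have hcs := sum_mul_density_sub_le hwpos hZ hpsum I hW2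
  have hsplit : ∑ y, I y * P 0 t x y =
      ∑ y, I y * (w y * (P 0 t x y / w y - (∑ y, w y)⁻¹)) + (∑ y, I y * w y) / ∑ y, w y := by
    rw [div_eq_mul_inv, Finset.sum_mul, ← Finset.sum_add_distrib]
    refine Finset.sum_congr rfl fun y _ => ?_
    have := (hwpos y).ne'
    field_simp
    ring
  have hprob : ℙ.real {ω | X t ω ∉ Umin U} ≤ ∑ y, I y * P 0 t x y := by
    calc ℙ.real {ω | X t ω ∉ Umin U}
        = ℙ.real (⋃ y ∈ Finset.univ.filter (fun y => y ∉ Umin U), {ω | X t ω = y}) := by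
          congr 1
          ext ω
          simp
      _ ≤ ∑ y ∈ Finset.univ.filter (fun y => y ∉ Umin U), ℙ.real {ω | X t ω = y} :=
          measureReal_biUnion_finset_le _ _
      _ ≤ ∑ y ∈ Finset.univ.filter (fun y => y ∉ Umin U), P 0 t x y :=
          Finset.sum_le_sum fun y _ => hXP t ht y
      _ = _ := by
          rw [Finset.sum_filter]
          refine Finset.sum_congr rfl fun y _ => ?_
          simp only [hI]
          split_ifs <;> simp
  have hdiv : (∑ y, I y * w y) / ∑ y, w y ≤ K * Real.exp (-(b * B)) := (div_le_iff₀ hZ).2 hW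
  have hsqrt : √(K * Real.exp (-(b * B))) = √K * Real.exp (-(b * (B / 2))) := by
    rw [Real.sqrt_mul hK, Real.sqrt_eq_rpow (Real.exp _), ← Real.exp_mul]
    congr 2
    ring
  rw [hsqrt] at hcs
  have hmul := mul_le_mul_of_nonneg_left hu
    (mul_nonneg (Real.sqrt_nonneg K) (Real.exp_pos (-(b * (B / 2)))).le)
  have e1 : Real.exp (-(b * B)) = Real.exp (-(b * (B / 2))) * Real.exp (-(b * (B / 2))) := by
    rw [← Real.exp_add]; congr 1; ring
  have e2 : Real.exp (-(b * (R + B / 2))) =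
      Real.exp (-(b * (B / 2))) * Real.exp (-(b * R)) := by
    rw [← Real.exp_add]; congr 1; ring
  have hKs : √K * √K = K := Real.mul_self_sqrt hK
  calc _ ≤ _ := hprob
    _ ≤ √K * Real.exp (-(b * (B / 2))) * (√((π x)⁻¹ - 1) * Real.exp (-(b * R)) +
          2 * √K * Real.exp (-(b * (B / 2)))) + K * Real.exp (-(b * B)) := by
        rw [hsplit]; linarith
    _ = 2 * (√K * √K) * Real.exp (-(b * B)) + K * Real.exp (-(b * B)) +
          √((π x)⁻¹ - 1) * √K * Real.exp (-(b * (R + B / 2))) := by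
        rw [e1, e2]; ring
    _ = _ := by rw [hKs]; ring

end Annealed

end Annealing

end

theorem corollary3p5 {S : Type*} [Fintype S] [DecidableEq S]
    (Q : Matrix S S ℝ) (π U : S → ℝ) (hQ : Annealing.IsProposal Q π)
    (hU : ⨅ x, U x = 0) (hc : 0 < Annealing.c₂ Q U) :
    (∃ γ : ∀ x y : S, Annealing.QPath Q x y, Annealing.IsOptimal U γ) ∧
    (∀ γ : ∀ x y : S, Annealing.QPath Q x y, Annealing.IsOptimal U γ →
      Annealing.IsGapConstant Q U (Annealing.pathA π U γ)) ∧
    ∀ A : ℝ, Annealing.IsGapConstant Q U A →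
      ∀ {Ω : Type*} [MeasurableSpace Ω] (ℙ : Measure Ω) [IsProbabilityMeasure ℙ]
        (x : S) (X : ℝ → Ω → S),
        Annealing.IsMarkovChain ℙ
          (fun t => Annealing.gen₂ Q U (Annealing.cooling Q U A t)) x X →
        ∀ t : ℝ, 0 ≤ t →
          ℙ.real {ω | X t ω ∉ Annealing.Umin U} ≤
            5 * Annealing.constK π U *
                (Annealing.rho Q U A * t + 1) ^ (-(Annealing.constB U / Annealing.c₂ Q U)) +
              ((π x)⁻¹ - 1) ^ (1 / 2 : ℝ) * Annealing.constK π U ^ (1 / 2 : ℝ) *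
                (Annealing.rho Q U A * t + 1) ^
                  (-((Annealing.constR U + Annealing.constB U / 2) / Annealing.c₂ Q U)) := by
  refine ⟨Annealing.exists_isOptimal hQ U,
    fun γ hγ => Annealing.isGapConstant_pathA hQ hU hc hγ,
    fun A hA Ω _ ℙ _ x X hX t ht => ?_⟩
  refine (Annealing.annealing_bound hQ hU hc hA ℙ x X hX ht).trans
    (add_le_add_left (mul_le_mul_of_nonneg_right ?_ (Real.rpow_nonneg ?_ _)) _)
  · linarith [Annealing.constK_nonneg (U := U) hQ]
  · have := Annealing.rho_pos hQ hU hc hA.1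
    positivity
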